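/- Let $Pr>0$ and let $\nu\in C^2([-\tfrac12,\tfrac12])$ be a positive, convex function (the viscosity profile). Write $D=d/dz$ and $\mathcal P f=D(\nu Df)-\nu k^2 f$, and for $k\neq 0$ and $\hat\sigma\ge 0$ put $\sigma=\hat\sigma k^2$. Consider, for a real number $R$, the eigenvalue problem on $(-\tfrac12,\tfrac12)$ $$\frac{\sigma}{Pr}Z=\nu(D^2-k^2)Z+\nu' DZ,$$ $$\sigma\Theta=(D^2-k^2)\Theta+W,$$ $$\frac{\sigma}{Pr}(D^2-k^2)W=-Rk^2\Theta-k^2\mathcal P W+D(\mathcal P(DW))+k^2\nu''W,$$ with the boundary conditions $Z=W=DW=\Theta=0$ at $z=-\tfrac12$ and $Z=W=D^2W=\Theta=0$ at $z=\tfrac12$. The unknown $(Z,\Theta,W)$ is complex valued and lies in $(H^1_0)^2\times H^2_0$, where $H^2_0$ denotes the functions of $H^2(-\tfrac12,\tfrac12)$ that satisfy the above boundary conditions for $W$; the equations hold in the sense of distributions. Let $\nu_{\min},\nu_{\max}$ be the minimum and the maximum of $\nu$ on $[-\tfrac12,\tfrac12]$, let $\delta_1=\pi^2\nu_{\min}/\nu_{\max}$,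 and $$R^*(k)=\Bigl(\nu_{\min}(k^2+\delta_1)+\min_{[-1/2,1/2]}\nu''\Bigr)(k^2+\pi^2).$$ Then there is a function $R_\perp$ such that for every $k\in\mathbb R\setminus\{0\}$ and every $\hat\sigma\ge 0$ (in particular for $\hat\sigma=0$) one has $R_\perp(k,\hat\sigma)\ge R^*(k)$, and for $R=R_\perp(k,\hat\sigma)$ the problem has a nontrivial solution $(Z,\Theta,W)\in(H^1_0)^2\times H^2_0$ that is unique up to multiplication by a scalar. -/

import Mathlib

open MeasureTheory Set Filter Topology
open scoped ContDiff

noncomputable section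

namespace Convection

/-- The (closed) layer `[-1/2, 1/2]`. -/
def layer : Set ℝ := Icc (-1 / 2) (1 / 2)

/-- Test functions: smooth, with compact support inside the open interval `(-1/2, 1/2)`. -/
def IsTest (φ : ℝ → ℝ) : Prop :=
  ContDiff ℝ ∞ φ ∧ HasCompactSupport φ ∧ tsupport φ ⊆ Ioo (-1 / 2) (1 / 2)

/-- The duality pairing `∫ f φ dz` over the layer. -/
def pair (f : ℝ → ℂ) (φ : ℝ → ℝ) : ℂ := ∫ z in (-1 / 2 : ℝ)..(1 / 2), φ z • f z

/-- `g` is the weak derivative of `f` on `(-1/2, 1/2)`. -/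
def HasWeakDeriv (f g : ℝ → ℂ) : Prop :=
  ∀ φ : ℝ → ℝ, IsTest φ → pair f (deriv φ) = -pair g φ

/-- `f` is square integrable on the layer. -/
def InL2 (f : ℝ → ℂ) : Prop := MemLp f 2 (volume.restrict layer)

/-- `f` belongs to `H¹(-1/2, 1/2)`, with weak derivative `f'`. An element of `H¹` is given
by its continuous representative on `[-1/2, 1/2]`, so that its boundary values are literal. -/
structure InH1 (f f' : ℝ → ℂ) : Prop where
  cont : ContinuousOn f layer
  weak : HasWeakDeriv f f'
  sq_int : InL2 f'

/-- `f` belongs to `H¹₀(-1/2, 1/2)`, with weak derivative `f'`. -/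
structure InH10 (f f' : ℝ → ℂ) : Prop extends InH1 f f' where
  left : f (-1 / 2) = 0
  right : f (1 / 2) = 0

/-- `W` belongs to the space `H²₀` of the problem, with weak derivatives `W₁ = DW` and
`W₂ = D²W`: `W` is in `H²` and satisfies `W = DW = 0` at `z = -1/2` and `W = D²W = 0` at
`z = 1/2`. As `D²W` is only an `L²` class, its boundary condition says that a representative
of it tends to `0` at `1/2`. -/
structure InH20 (W W₁ W₂ : ℝ → ℂ) : Prop where
  memW : InH1 W W₁
  memDW : InH1 W₁ W₂
  left : W (-1 / 2) = 0
  right : W (1 / 2) = 0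
  noslip : W₁ (-1 / 2) = 0
  freeslip : Tendsto W₂ (𝓝[<] (1 / 2)) (𝓝 0)

/-- The second derivative `ν''` of the viscosity profile on the layer (one-sided at the ends). -/
def nuSecond (ν : ℝ → ℝ) : ℝ → ℝ := iteratedDerivWithin 2 ν layer

/-- The distribution `𝒫 f = D (ν D f) - ν k² f` tested against `φ`, where `f' = D f`. -/
def opP (ν : ℝ → ℝ) (k : ℝ) (f f' : ℝ → ℂ) (φ : ℝ → ℝ) : ℂ :=
  -pair (fun z => ν z • f' z) (deriv φ) - k ^ 2 * pair (fun z => ν z • f z) φ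

/-- `(Z, Θ, W) ∈ (H¹₀)² × H²₀` solves, in the sense of distributions on `(-1/2, 1/2)`,
* `(σ / Pr) Z = ν (D² - k²) Z + ν' D Z = 𝒫 Z`,
* `σ Θ = (D² - k²) Θ + W`,
* `(σ / Pr) (D² - k²) W = - R k² Θ - k² 𝒫 W + D (𝒫 (D W)) + k² ν'' W`,

together with the boundary conditions contained in the spaces. -/
def IsSolution (ν : ℝ → ℝ) (Pr k σ R : ℝ) (Z Θ W : ℝ → ℂ) : Prop :=
  ∃ Z₁ Θ₁ W₁ W₂ : ℝ → ℂ, InH10 Z Z₁ ∧ InH10 Θ Θ₁ ∧ InH20 W W₁ W₂ ∧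
    ∀ φ : ℝ → ℝ, IsTest φ →
      (σ / Pr : ℂ) * pair Z φ = opP ν k Z Z₁ φ ∧
      σ * pair Θ φ = -pair Θ₁ (deriv φ) - k ^ 2 * pair Θ φ + pair W φ ∧
      (σ / Pr : ℂ) * (pair W₂ φ - k ^ 2 * pair W φ) =
        -(R * k ^ 2 * pair Θ φ) - k ^ 2 * opP ν k W W₁ φ - opP ν k W₁ W₂ (deriv φ)
          + k ^ 2 * pair (fun z => nuSecond ν z • W z) φ

/-- The minimum of the viscosity on the layer. -/
def nuMin (ν : ℝ → ℝ) : ℝ := sInf (ν '' layer)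

/-- The maximum of the viscosity on the layer. -/
def nuMax (ν : ℝ → ℝ) : ℝ := sSup (ν '' layer)

/-- The constant `δ₁ = π² ν_min / ν_max` of the weighted Poincaré inequality. -/
def delta1 (ν : ℝ → ℝ) : ℝ := Real.pi ^ 2 * nuMin ν / nuMax ν

/-- The lower bound
`R*(k) = (min ν (k² + δ₁) + k² min (d_h² ν)) (k² + π²)`, where `d_h² ν = ν'' / k²`. -/
def rStar (ν : ℝ → ℝ) (k : ℝ) : ℝ :=
  (nuMin ν * (k ^ 2 + delta1 ν) + k ^ 2 * sInf ((fun z => nuSecond ν z / k ^ 2) '' layer)) *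
    (k ^ 2 + Real.pi ^ 2)

/-- The eigenvalue problem has a nontrivial solution, and it is the only one up to a scalar
factor. -/
def HasUniqueNontrivialSolution (ν : ℝ → ℝ) (Pr k σ R : ℝ) : Prop :=
  ∃ Z Θ W : ℝ → ℂ, IsSolution ν Pr k σ R Z Θ W ∧
    (∃ z ∈ layer, Z z ≠ 0 ∨ Θ z ≠ 0 ∨ W z ≠ 0) ∧
    ∀ Z' Θ' W' : ℝ → ℂ, IsSolution ν Pr k σ R Z' Θ' W' →
      ∃ c : ℂ, ∀ z ∈ layer, Z' z = c * Z z ∧ Θ' z = c * Θ z ∧ W' z = c * W z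

end Convection

end

/-! The vertical vorticity decouples, and its energy identity forces `Z = 0`. With s = σ/Pr, l = R
k² and κ = k² + σ, the rest becomes (ν W'')'' - (b W')' + c W = l Θ, Θ'' = κ Θ - W, where b = 2k²ν +
s and c = k⁴ν + k²ν'' + s k² are nonnegative, the latter by convexity of ν. Only a lower bound is
asked of `Rperp`, so the precise value of R* is immaterial: it suffices to find, above any given
number, an eigenvalue whose eigenspace is a line. Two facts give this.

Large eigenvalues are simple (`ClassicalSol.eq_zero`). Multiplying the first equation by p Θ', with
p vanishing at 1/2, and integrating by parts yields a Rellich identity in which l Θ² and W'² have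
positive coefficients and whose boundary terms vanish if Θ'(-1/2) = 0. For large l the remaining
terms can be absorbed, so Θ'(-1/2) = 0 forces the solution to vanish. Two eigenfunctions are
therefore proportional.

There are arbitrarily large eigenvalues (`exists_large_classicalSol`). In the L² unknowns u = W'', v
= Θ' the problem is B u = l G† v, D v = G u, with B and D bounded, symmetric and coercive, and G
compact and injective, built from the Volterra operator. Eliminating v gives B u = l C u with C = G†
D⁻¹ G compact and positive definite on an infinite-dimensional space, so the values of l are
unbounded above.

Du Bois-Reymond arguments turn weak and variational solutions into classical ones; W'' = 0 at 1/2
appears as the natural boundary condition. -/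

namespace Convection

/-! ### The boundary value problem as a first-order system -/

/-- The first-order form of the boundary value problem for `(Θ, W)`, with `M = ν D²W`,
`N = D M - b D W` and `T = D Θ`. -/
structure ClassicalSol {E : Type*} [NormedAddCommGroup E] [NormedSpace ℝ E]
    (ν b c : ℝ → ℝ) (κ l : ℝ) (W W₁ M N Θ T : ℝ → E) : Prop where
  contW : ContinuousOn W layer
  contW₁ : ContinuousOn W₁ layer
  contM : ContinuousOn M layer
  contN : ContinuousOn N layer
  contΘ : ContinuousOn Θ layer
  contT : ContinuousOn T layer
  derivW : ∀ z ∈ Ioo (-1 / 2 : ℝ) (1 / 2), HasDerivAt W (W₁ z) z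
  derivW₁ : ∀ z ∈ Ioo (-1 / 2 : ℝ) (1 / 2), HasDerivAt W₁ ((ν z)⁻¹ • M z) z
  derivM : ∀ z ∈ Ioo (-1 / 2 : ℝ) (1 / 2), HasDerivAt M (N z + b z • W₁ z) z
  derivN : ∀ z ∈ Ioo (-1 / 2 : ℝ) (1 / 2), HasDerivAt N (l • Θ z - c z • W z) z
  derivΘ : ∀ z ∈ Ioo (-1 / 2 : ℝ) (1 / 2), HasDerivAt Θ (T z) z
  derivT : ∀ z ∈ Ioo (-1 / 2 : ℝ) (1 / 2), HasDerivAt T (κ • Θ z - W z) z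
  leftW : W (-1 / 2) = 0
  leftW₁ : W₁ (-1 / 2) = 0
  leftΘ : Θ (-1 / 2) = 0
  rightW : W (1 / 2) = 0
  rightM : M (1 / 2) = 0
  rightΘ : Θ (1 / 2) = 0

/-- The coefficients are real, so real and imaginary parts of a solution are solutions; this reduces
the Rellich argument to real functions. -/
theorem ClassicalSol.map {E F : Type*} [NormedAddCommGroup E] [NormedSpace ℝ E]
    [NormedAddCommGroup F] [NormedSpace ℝ F] (f : E →L[ℝ] F)
    {ν b c : ℝ → ℝ} {κ l : ℝ} {W W₁ M N Θ T : ℝ → E}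
    (h : ClassicalSol ν b c κ l W W₁ M N Θ T) :
    ClassicalSol ν b c κ l (fun z => f (W z)) (fun z => f (W₁ z)) (fun z => f (M z))
      (fun z => f (N z)) (fun z => f (Θ z)) (fun z => f (T z)) where
  contW := f.continuous.comp_continuousOn h.contW
  contW₁ := f.continuous.comp_continuousOn h.contW₁
  contM := f.continuous.comp_continuousOn h.contM
  contN := f.continuous.comp_continuousOn h.contN
  contΘ := f.continuous.comp_continuousOn h.contΘ
  contT := f.continuous.comp_continuousOn h.contT
  derivW z hz := f.hasFDerivAt.comp_hasDerivAt z (h.derivW z hz)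
  derivW₁ z hz := (f.hasFDerivAt.comp_hasDerivAt z (h.derivW₁ z hz)).congr_deriv (by simp)
  derivM z hz := (f.hasFDerivAt.comp_hasDerivAt z (h.derivM z hz)).congr_deriv (by simp)
  derivN z hz := (f.hasFDerivAt.comp_hasDerivAt z (h.derivN z hz)).congr_deriv (by simp)
  derivΘ z hz := f.hasFDerivAt.comp_hasDerivAt z (h.derivΘ z hz)
  derivT z hz := (f.hasFDerivAt.comp_hasDerivAt z (h.derivT z hz)).congr_deriv (by simp)
  leftW := by simp [h.leftW]
  leftW₁ := by simp [h.leftW₁]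
  leftΘ := by simp [h.leftΘ]
  rightW := by simp only [h.rightW, map_zero]
  rightM := by simp only [h.rightM, map_zero]
  rightΘ := by simp only [h.rightΘ, map_zero]

/-- Used with the factor that makes the combination of the two `T` vanish at -1/2. -/
theorem ClassicalSol.sub_smul {ν b c : ℝ → ℝ} {κ l : ℝ} {W W₁ M N Θ T W' W₁' M' N' Θ' T' : ℝ → ℂ}
    (h' : ClassicalSol ν b c κ l W' W₁' M' N' Θ' T') (h : ClassicalSol ν b c κ l W W₁ M N Θ T)
    (a : ℂ) :
    ClassicalSol ν b c κ l (fun z => W' z - a * W z) (fun z => W₁' z - a * W₁ z)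
      (fun z => M' z - a * M z) (fun z => N' z - a * N z) (fun z => Θ' z - a * Θ z)
      (fun z => T' z - a * T z) where
  contW := h'.contW.sub (continuousOn_const.mul h.contW)
  contW₁ := h'.contW₁.sub (continuousOn_const.mul h.contW₁)
  contM := h'.contM.sub (continuousOn_const.mul h.contM)
  contN := h'.contN.sub (continuousOn_const.mul h.contN)
  contΘ := h'.contΘ.sub (continuousOn_const.mul h.contΘ)
  contT := h'.contT.sub (continuousOn_const.mul h.contT)
  derivW z hz := (h'.derivW z hz).sub ((h.derivW z hz).const_mul a)
  derivW₁ z hz := by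
    refine ((h'.derivW₁ z hz).sub ((h.derivW₁ z hz).const_mul a)).congr_deriv ?_
    simp only [Complex.real_smul]; ring
  derivM z hz := by
    refine ((h'.derivM z hz).sub ((h.derivM z hz).const_mul a)).congr_deriv ?_
    simp only [Complex.real_smul]; ring
  derivN z hz := by
    refine ((h'.derivN z hz).sub ((h.derivN z hz).const_mul a)).congr_deriv ?_
    simp only [Complex.real_smul]; ring
  derivΘ z hz := (h'.derivΘ z hz).sub ((h.derivΘ z hz).const_mul a)
  derivT z hz := by
    refine ((h'.derivT z hz).sub ((h.derivT z hz).const_mul a)).congr_deriv ?_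
    simp only [Complex.real_smul]; ring
  leftW := by simp [h.leftW, h'.leftW]
  leftW₁ := by simp [h.leftW₁, h'.leftW₁]
  leftΘ := by simp [h.leftΘ, h'.leftΘ]
  rightW := by simp only [h.rightW, h'.rightW, mul_zero, sub_zero]
  rightM := by simp only [h.rightM, h'.rightM, mul_zero, sub_zero]
  rightΘ := by simp only [h.rightΘ, h'.rightΘ, mul_zero, sub_zero]

/-! ### Rellich's identity and the simplicity of large eigenvalues -/

theorem eqOn_zero_of_integral_le_zero {f g : ℝ → ℝ} (hf : ContinuousOn f layer)
    (hfg : ∀ z ∈ layer, g z ^ 2 ≤ f z)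
    (hint : ∫ z in (-1 / 2 : ℝ)..(1 / 2), f z ≤ 0) : ∀ z ∈ layer, g z = 0 := by
  by_contra! H
  obtain ⟨z, hz, hz0⟩ := H
  refine absurd hint (not_le.2 ?_)
  refine intervalIntegral.integral_pos (by norm_num) hf
    (fun x hx => (sq_nonneg _).trans (hfg x (Ioc_subset_Icc_self hx))) ⟨z, hz, ?_⟩
  exact lt_of_lt_of_le (by positivity) (hfg z hz)

/-- The quadratic form produced by the Rellich identity is positive definite when the
coefficient `l` of `Θ²` is large. -/
theorem lower_order_bound {δ C κ : ℝ} (hδ : 0 < δ) (hC : 0 ≤ C) :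
    ∃ α β Λ : ℝ, ∀ l, Λ ≤ l → ∀ w w₁ t θ G A₁ A₂ A₃ A₄ : ℝ, l / 2 * θ ^ 2 + δ * w₁ ^ 2 ≤ G →
      |A₁| ≤ C → |A₂| ≤ C → |A₃| ≤ C → |A₄| ≤ C →
      w ^ 2 + θ ^ 2 ≤ G - (w₁ * (A₁ * t + A₂ * w + A₃ * θ) + A₄ * w * t)
        + α * (w ^ 2 - w₁ * t - κ * w * θ) + β * (t ^ 2 + κ * θ ^ 2 - w * θ) := by
  -- The constants are chosen in the order α, β, threshold for l: α makes the w² term dominate, β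
  -- then pays for the t² produced by α w₁ t, and l finally pays for every θ² term.
  obtain ⟨D, hD⟩ : ∃ D, D = 3 * C ^ 2 / (2 * δ) + C := ⟨_, rfl⟩
  obtain ⟨α, hα⟩ : ∃ α, α = D + 2 := ⟨_, rfl⟩
  obtain ⟨β, hβ⟩ : ∃ β, β = D + α ^ 2 / δ := ⟨_, rfl⟩
  obtain ⟨γ, hγ⟩ : ∃ γ, γ = α * κ + β := ⟨_, rfl⟩
  refine ⟨α, β, 2 * (D + γ ^ 2 / 4 + 1 - β * κ), fun l hl w w₁ t θ G A₁ A₂ A₃ A₄ hG h₁ h₂ h₃ h₄ => ?_⟩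
  -- Young's inequality: the three products with w₁ cost δ/2 of w₁² in all, and α w₁ t costs a
  -- further δ/4.
  have key : ∀ A x : ℝ, |A| ≤ C → w₁ * (A * x) ≤ δ / 6 * w₁ ^ 2 + 3 * C ^ 2 / (2 * δ) * x ^ 2 := by
    intro A x hA
    have hA2 : A ^ 2 ≤ C ^ 2 := sq_le_sq' (by linarith [neg_abs_le A]) ((le_abs_self A).trans hA)
    have h0 : 0 ≤ 3 / (2 * δ) * (δ / 3 * w₁ - A * x) ^ 2 := by positivity
    have h1 : 3 / (2 * δ) * (δ / 3 * w₁ - A * x) ^ 2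
        = δ / 6 * w₁ ^ 2 - w₁ * (A * x) + 3 * A ^ 2 / (2 * δ) * x ^ 2 := by field_simp; ring
    have h2 : 3 * A ^ 2 / (2 * δ) * x ^ 2 ≤ 3 * C ^ 2 / (2 * δ) * x ^ 2 := by gcongr
    linarith
  have k₁ := key A₁ t h₁
  have k₂ := key A₂ w h₂
  have k₃ := key A₃ θ h₃
  have k₄ : A₄ * w * t ≤ C * w ^ 2 + C * t ^ 2 := by
    have : A₄ * (w * t) ≤ C * |w * t| :=
      (le_abs_self _).trans (by rw [abs_mul]; gcongr)
    rw [abs_mul] at this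
    nlinarith [sq_nonneg (|w| - |t|), sq_abs w, sq_abs t, sq_nonneg w, sq_nonneg t]
  have k₅ : α * (w₁ * t) ≤ δ / 4 * w₁ ^ 2 + α ^ 2 / δ * t ^ 2 := by
    have h0 : 0 ≤ 1 / δ * (δ / 2 * w₁ - α * t) ^ 2 := by positivity
    have h1 : 1 / δ * (δ / 2 * w₁ - α * t) ^ 2
        = δ / 4 * w₁ ^ 2 - α * (w₁ * t) + α ^ 2 / δ * t ^ 2 := by field_simp; ring
    linarith
  have k₆ : γ * (w * θ) ≤ w ^ 2 + γ ^ 2 / 4 * θ ^ 2 := by nlinarith [sq_nonneg (w - γ / 2 * θ)]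
  have k₇ : (D + γ ^ 2 / 4 + 1 - β * κ) * θ ^ 2 ≤ l / 2 * θ ^ 2 := by gcongr; linarith
  have e₆ : γ * (w * θ) = α * κ * (w * θ) + β * (w * θ) := by rw [hγ]; ring
  have hDθ : 3 * C ^ 2 / (2 * δ) * θ ^ 2 = D * θ ^ 2 - C * θ ^ 2 := by rw [hD]; ring
  have hDt : 3 * C ^ 2 / (2 * δ) * t ^ 2 = D * t ^ 2 - C * t ^ 2 := by rw [hD]; ring
  have hDw : 3 * C ^ 2 / (2 * δ) * w ^ 2 = D * w ^ 2 - C * w ^ 2 := by rw [hD]; ring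
  have eβ : β * t ^ 2 = D * t ^ 2 + α ^ 2 / δ * t ^ 2 := by rw [hβ]; ring
  have eα : α * w ^ 2 = D * w ^ 2 + 2 * w ^ 2 := by rw [hα]; ring
  have hCθ : 0 ≤ C * θ ^ 2 := by positivity
  have hδw : 0 ≤ δ * w₁ ^ 2 := by positivity
  linarith [k₁, k₂, k₃, k₄, k₅, k₆, k₇]

theorem exists_abs_bound {f : ℝ → ℝ} (hf : ContinuousOn f layer) : ∃ C, ∀ z ∈ layer, |f z| ≤ C :=
  isCompact_Icc.exists_bound_of_continuousOn hf

theorem exists_pos_lower_bound {ν : ℝ → ℝ} (hν : ContinuousOn ν layer)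
    (hpos : ∀ z ∈ layer, 0 < ν z) : ∃ m, 0 < m ∧ ∀ z ∈ layer, m ≤ ν z := by
  obtain ⟨x, hx, hmin⟩ := isCompact_Icc.exists_isMinOn ⟨(-1 / 2 : ℝ), by norm_num⟩ hν
  exact ⟨ν x, hpos x hx, fun z hz => hmin hz⟩

/-- Rellich's identity with the multiplier `sinh (m (1/2 - z)) DΘ` shows that an eigenfunction
with a large eigenvalue is determined by `DΘ` at the left end. -/
theorem ClassicalSol.eq_zero {ν ν₁ b c : ℝ → ℝ} (κ : ℝ)
    (hν : ContinuousOn ν layer) (hν₁ : ContinuousOn ν₁ layer)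
    (hν' : ∀ z ∈ Ioo (-1 / 2 : ℝ) (1 / 2), HasDerivAt ν (ν₁ z) z)
    (hpos : ∀ z ∈ layer, 0 < ν z) (hb : ContinuousOn b layer) (hc : ContinuousOn c layer) :
    ∃ Λ : ℝ, ∀ l, Λ ≤ l → ∀ W W₁ M N Θ T : ℝ → ℝ, ClassicalSol ν b c κ l W W₁ M N Θ T →
      T (-1 / 2) = 0 → ∀ z ∈ layer, W z = 0 ∧ Θ z = 0 := by
  obtain ⟨n₀, hn₀, hn₀'⟩ := exists_pos_lower_bound hν hpos
  obtain ⟨C₁, hC₁⟩ := exists_abs_bound hν₁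
  -- This m gives |ν'| ≤ m n₀; as m p ≤ q, the term p ν' is dominated by q ν.
  obtain ⟨m, hm⟩ : ∃ m, m = 1 + |C₁| / n₀ := ⟨_, rfl⟩
  have hm1 : 1 ≤ m := by rw [hm]; have : 0 ≤ |C₁| / n₀ := by positivity
                         linarith
  -- The multiplier is nonnegative, vanishes at 1/2, and satisfies p' = -q, q' = -m² p.
  obtain ⟨p, hp⟩ : ∃ p : ℝ → ℝ, p = fun z => Real.sinh (m * (1 / 2 - z)) := ⟨_, rfl⟩
  obtain ⟨q, hq⟩ : ∃ q : ℝ → ℝ, q = fun z => m * Real.cosh (m * (1 / 2 - z)) := ⟨_, rfl⟩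
  have hlin (z : ℝ) : HasDerivAt (fun z : ℝ => m * (1 / 2 - z)) (-m) z := by
    exact (((hasDerivAt_id z).const_sub (1 / 2)).const_mul m).congr_deriv (by ring)
  have hp' (z : ℝ) : HasDerivAt p (-q z) z := by
    rw [hp, hq]; exact (hlin z).sinh.congr_deriv (by ring)
  have hq' (z : ℝ) : HasDerivAt q (-(m ^ 2 * p z)) z := by
    rw [hp, hq]; exact ((hlin z).cosh.const_mul m).congr_deriv (by ring)
  have hpc : ContinuousOn p layer := fun z _ => (hp' z).continuousAt.continuousWithinAt
  have hqc : ContinuousOn q layer := fun z _ => (hq' z).continuousAt.continuousWithinAt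
  have hq1 (z : ℝ) : m ≤ q z := by
    rw [hq]; nlinarith [Real.one_le_cosh (m * (1 / 2 - z))]
  have hp0 : ∀ z ∈ layer, 0 ≤ p z := fun z hz => by
    rw [hp]; exact Real.sinh_nonneg_iff.2 (mul_nonneg (by linarith) (by linarith [hz.2]))
  have hpq (z : ℝ) : m * p z ≤ q z := by
    rw [hp, hq]; exact mul_le_mul_of_nonneg_left (Real.sinh_lt_cosh _).le (by linarith)
  have hpr : p (1 / 2) = 0 := by rw [hp]; simp
  -- `A₁`, ..., `A₄` are the coefficients of W₁T, W₁W, W₁Θ and WT left over in the identity. None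
  -- involves l, so their bounds are uniform in l.
  obtain ⟨A₁, hA₁⟩ : ∃ A : ℝ → ℝ, A = fun z => q z * b z + m ^ 2 * (p z * ν₁ z - q z * ν z)
      - 2 * κ * (q z * ν z) + κ * (p z * ν₁ z - q z * ν z) := ⟨_, rfl⟩
  obtain ⟨A₂, hA₂⟩ : ∃ A : ℝ → ℝ, A = fun z => p z * b z
      + 2 * (q z * ν₁ z - m ^ 2 * (p z * ν z)) - m ^ 2 * (p z * ν z)
      - κ * (p z * ν z) := ⟨_, rfl⟩
  obtain ⟨A₃, hA₃⟩ : ∃ A : ℝ → ℝ, A = fun z => -(κ * (p z * b z)) + κ * m ^ 2 * (p z * ν z)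
      + 2 * κ * (m ^ 2 * (p z * ν z) - q z * ν₁ z) + κ ^ 2 * (p z * ν z) := ⟨_, rfl⟩
  obtain ⟨A₄, hA₄⟩ : ∃ A : ℝ → ℝ, A = fun z => -(p z * c z) := ⟨_, rfl⟩
  obtain ⟨D₁, hD₁⟩ := exists_abs_bound (f := A₁) (by rw [hA₁]; fun_prop)
  obtain ⟨D₂, hD₂⟩ := exists_abs_bound (f := A₂) (by rw [hA₂]; fun_prop)
  obtain ⟨D₃, hD₃⟩ := exists_abs_bound (f := A₃) (by rw [hA₃]; fun_prop)
  obtain ⟨D₄, hD₄⟩ := exists_abs_bound (f := A₄) (by rw [hA₄]; fun_prop)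
  obtain ⟨α, β, Λ, hΛ⟩ := lower_order_bound (δ := n₀) (C := |D₁| + |D₂| + |D₃| + |D₄|) (κ := κ) hn₀
    (by positivity)
  refine ⟨max Λ 0, fun l hl W W₁ M N Θ T h hT => ?_⟩
  have hl0 : 0 ≤ l := (le_max_right _ _).trans hl
  obtain ⟨cW, cW₁, cM, cN, cΘ, cT, dW, dW₁, dM, dN, dΘ, dT, lW, lW₁, lΘ, rW, rM, rΘ⟩ := h
  -- The terms following p N T in the large bracket remove N and M from the derivative, through N =
  -- M' - b W₁ and M = ν W₁', and turn l p Θ T into l q Θ²/2. The last two terms, -α W T and β Θ T,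
  -- supply α W² and β T².
  obtain ⟨Q, hQ⟩ : ∃ Q : ℝ → ℝ, Q = fun z => (p z * N z * T z + q z * M z * T z
      - l / 2 * (p z * Θ z ^ 2) - κ * (p z * Θ z * M z) + p z * M z * W z
      + 2 * (q z * ν z * W₁ z * W z) - p z * ν z * W₁ z ^ 2 / 2 + m ^ 2 * (p z * ν z * W₁ z * T z)
      - 2 * κ * (q z * ν z * W₁ z * Θ z) + κ * (p z * ν z * W₁ z * T z))
      - α * (W z * T z) + β * (Θ z * T z) := ⟨_, rfl⟩
  obtain ⟨G, hG⟩ : ∃ G : ℝ → ℝ, G = fun z => l / 2 * (q z * Θ z ^ 2)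
      + (5 / 2 * (q z * ν z) - p z * ν₁ z / 2) * W₁ z ^ 2 := ⟨_, rfl⟩
  obtain ⟨F, hF⟩ : ∃ F : ℝ → ℝ, F = fun z =>
      G z + (W₁ z * (A₁ z * T z + A₂ z * W z + A₃ z * Θ z) + A₄ z * W z * T z)
        + α * (W z ^ 2 - W₁ z * T z - κ * W z * Θ z)
        + β * (T z ^ 2 + κ * Θ z ^ 2 - W z * Θ z) := ⟨_, rfl⟩
  have cQ : ContinuousOn Q layer := by rw [hQ]; fun_prop
  have cF : ContinuousOn F layer := by rw [hF, hG, hA₁, hA₂, hA₃, hA₄]; fun_prop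
  have dQ : ∀ z ∈ Ioo (-1 / 2 : ℝ) (1 / 2), HasDerivAt Q (F z) z := by
    intro z hz
    have hνz : ν z ≠ 0 := (hpos z (Ioo_subset_Icc_self hz)).ne'
    have hdp := hp' z
    have hdq := hq' z
    have hdν := hν' z hz
    have hW := dW z hz
    have hW₁ := dW₁ z hz
    have hM := dM z hz
    have hN := dN z hz
    have hΘ := dΘ z hz
    have hT := dT z hz
    have hpνW := (hdp.mul hdν).mul hW₁
    have hqνW := (hdq.mul hdν).mul hW₁
    have h1 := (hdp.mul hN).mul hT
    have h2 := (hdq.mul hM).mul hT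
    have h3 := (hdp.mul (hΘ.pow 2)).const_mul (l / 2)
    have h4 := ((hdp.mul hΘ).mul hM).const_mul κ
    have h5 := (hdp.mul hM).mul hW
    have h6 := (hqνW.mul hW).const_mul 2
    have h7 := ((hdp.mul hdν).mul (hW₁.pow 2)).div_const 2
    have h8 := (hpνW.mul hT).const_mul (m ^ 2)
    have h9 := (hqνW.mul hΘ).const_mul (2 * κ)
    have h10 := (hpνW.mul hT).const_mul κ
    have h11 := (hW.mul hT).const_mul α
    have h12 := (hΘ.mul hT).const_mul β
    have := ((((((((((h1.add h2).sub h3).sub h4).add h5).add h6).sub h7).add h8).sub h9).add h10).sub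
      h11).add h12
    rw [hQ]
    refine this.congr_deriv ?_
    simp only [hF, hG, hA₁, hA₂, hA₃, hA₄, smul_eq_mul, Pi.mul_apply, Pi.pow_apply]
    field_simp
    ring
  have hint : ∫ z in (-1 / 2 : ℝ)..(1 / 2), F z = Q (1 / 2) - Q (-1 / 2) :=
    intervalIntegral.integral_eq_sub_of_hasDerivAt_of_le (by norm_num) cQ dQ
      (ContinuousOn.intervalIntegrable_of_Icc (by norm_num) cF)
  -- Every term of Q contains one of p, W, M, Θ, which vanish at 1/2, and one of W, W₁, Θ, T, which
  -- vanish at -1/2.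
  have hQr : Q (1 / 2) = 0 := by rw [hQ]; simp only [rW, rM, rΘ, hpr]; ring
  have hQl : Q (-1 / 2) = 0 := by rw [hQ]; simp only [lW, lW₁, lΘ, hT]; ring
  have hFlow : ∀ z ∈ layer, W z ^ 2 + Θ z ^ 2 ≤ F z := by
    intro z hz
    have hGz : l / 2 * Θ z ^ 2 + n₀ * W₁ z ^ 2 ≤ G z := by
      have e1 : l / 2 * Θ z ^ 2 ≤ l / 2 * (q z * Θ z ^ 2) := by
        have := hq1 z
        have h2 : 1 * Θ z ^ 2 ≤ q z * Θ z ^ 2 := by gcongr; linarith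
        have h3 : 0 ≤ l / 2 := by positivity
        nlinarith
      have hC : |C₁| ≤ m * n₀ := by
        have : m * n₀ = n₀ + |C₁| := by rw [hm]; field_simp
        linarith
      have e2 : p z * ν₁ z ≤ q z * n₀ := by
        have h1 : p z * ν₁ z ≤ p z * (m * n₀) :=
          mul_le_mul_of_nonneg_left ((le_abs_self _).trans
            ((hC₁ z hz).trans ((le_abs_self _).trans hC))) (hp0 z hz)
        have h2 : m * p z * n₀ ≤ q z * n₀ := mul_le_mul_of_nonneg_right (hpq z) hn₀.le
        linarith
      have e3 : q z * n₀ ≤ q z * ν z :=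
        mul_le_mul_of_nonneg_left (hn₀' z hz) (by linarith [hq1 z])
      have e4 : n₀ ≤ q z * n₀ := le_mul_of_one_le_left hn₀.le (hm1.trans (hq1 z))
      have e5 : n₀ * W₁ z ^ 2 ≤ (5 / 2 * (q z * ν z) - p z * ν₁ z / 2) * W₁ z ^ 2 := by
        gcongr; linarith
      rw [hG]; exact add_le_add e1 e5
    have bound (x D : ℝ) (hx : |x| ≤ D) (hD : |D| ≤ |D₁| + |D₂| + |D₃| + |D₄|) :
        |-x| ≤ |D₁| + |D₂| + |D₃| + |D₄| := by
      rw [abs_neg]; exact hx.trans ((le_abs_self _).trans hD)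
    have n1 := abs_nonneg D₁
    have n2 := abs_nonneg D₂
    have n3 := abs_nonneg D₃
    have n4 := abs_nonneg D₄
    have := hΛ l ((le_max_left _ _).trans hl) (W z) (W₁ z) (T z) (Θ z) (G z) (-A₁ z) (-A₂ z) (-A₃ z)
      (-A₄ z) hGz (bound _ _ (hD₁ z hz) (by linarith)) (bound _ _ (hD₂ z hz) (by linarith))
      (bound _ _ (hD₃ z hz) (by linarith)) (bound _ _ (hD₄ z hz) (by linarith))
    rw [hF]
    linarith
  have hle : ∫ z in (-1 / 2 : ℝ)..(1 / 2), F z ≤ 0 := by rw [hint, hQr, hQl, sub_zero]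
  intro z hz
  exact ⟨eqOn_zero_of_integral_le_zero cF
      (fun z hz => (le_add_of_nonneg_right (sq_nonneg _)).trans (hFlow z hz)) hle z hz,
    eqOn_zero_of_integral_le_zero cF
      (fun z hz => (le_add_of_nonneg_left (sq_nonneg _)).trans (hFlow z hz)) hle z hz⟩

/-! ### Test functions, pairings and the du Bois-Reymond lemma -/

protected theorem IsTest.deriv {φ : ℝ → ℝ} (h : IsTest φ) : IsTest (deriv φ) :=
  ⟨(contDiff_infty_iff_deriv.1 h.1).2, h.2.1.deriv,
    (closure_minimal (support_deriv_subset (f := φ)) (isClosed_tsupport φ)).trans h.2.2⟩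

theorem IsTest.hasDerivAt {φ : ℝ → ℝ} (h : IsTest φ) (z : ℝ) : HasDerivAt φ (deriv φ z) z :=
  (h.1.differentiable (by simp) z).hasDerivAt

theorem IsTest.eq_zero {φ : ℝ → ℝ} (h : IsTest φ) {z : ℝ} (hz : z ∉ Ioo (-1 / 2 : ℝ) (1 / 2)) :
    φ z = 0 :=
  image_eq_zero_of_notMem_tsupport fun hm => hz (h.2.2 hm)

theorem IsTest.continuous {φ : ℝ → ℝ} (h : IsTest φ) : Continuous φ := h.1.continuous

theorem IsTest.linearComb {φ ψ : ℝ → ℝ} (hφ : IsTest φ) (hψ : IsTest ψ) (a : ℝ) :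
    IsTest fun z => φ z - a * ψ z := by
  refine ⟨hφ.1.sub (contDiff_const.mul hψ.1), hφ.2.1.sub (hψ.2.1.mul_left), ?_⟩
  refine (tsupport_sub φ (fun z => a * ψ z)).trans (union_subset hφ.2.2 ?_)
  exact (tsupport_mul_subset_right (f := fun _ => a) (g := ψ)).trans hψ.2.2

/-- Integrability over the layer. -/
abbrev IL (f : ℝ → ℂ) : Prop := IntervalIntegrable f volume (-1 / 2) (1 / 2)

theorem uIcc_layer : uIcc (-1 / 2 : ℝ) (1 / 2) = layer := uIcc_of_le (by norm_num)

theorem IL.of_continuousOn {f : ℝ → ℂ} (hf : ContinuousOn f layer) : IL f :=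
  ContinuousOn.intervalIntegrable (by rwa [uIcc_layer])

theorem InL2.il {f : ℝ → ℂ} (hf : InL2 f) : IL f := by
  have : IsFiniteMeasure (volume.restrict layer) := ⟨by simp [layer]⟩
  rw [IL, intervalIntegrable_iff_integrableOn_Icc_of_le (by norm_num)]
  exact hf.integrable (by norm_num)

theorem InL2.of_continuousOn {f : ℝ → ℂ} (hf : ContinuousOn f layer) : InL2 f := by
  have : IsFiniteMeasure (volume.restrict layer) := ⟨by simp [layer]⟩
  obtain ⟨C, hC⟩ := isCompact_Icc.exists_bound_of_continuousOn hf
  refine MemLp.of_bound (hf.aestronglyMeasurable measurableSet_Icc) C ?_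
  exact (ae_restrict_iff' measurableSet_Icc).2 (ae_of_all _ hC)

theorem IL.smul {ν : ℝ → ℝ} {f : ℝ → ℂ} (hf : IL f) (hν : ContinuousOn ν layer) :
    IL fun z => ν z • f z :=
  IntervalIntegrable.continuousOn_smul hf (by rwa [uIcc_layer])

theorem IsTest.il_smul {φ : ℝ → ℝ} (hφ : IsTest φ) {f : ℝ → ℂ} (hf : IL f) :
    IL fun z => φ z • f z := hf.smul hφ.continuous.continuousOn

theorem pair_add {φ : ℝ → ℝ} (hφ : IsTest φ) {f g : ℝ → ℂ} (hf : IL f) (hg : IL g) :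
    pair (fun z => f z + g z) φ = pair f φ + pair g φ := by
  simp only [pair, smul_add]
  exact intervalIntegral.integral_add (hφ.il_smul hf) (hφ.il_smul hg)

theorem pair_sub {φ : ℝ → ℝ} (hφ : IsTest φ) {f g : ℝ → ℂ} (hf : IL f) (hg : IL g) :
    pair (fun z => f z - g z) φ = pair f φ - pair g φ := by
  simp only [pair, smul_sub]
  exact intervalIntegral.integral_sub (hφ.il_smul hf) (hφ.il_smul hg)

theorem pair_smul (a : ℝ) (f : ℝ → ℂ) (φ : ℝ → ℝ) :
    pair (fun z => a • f z) φ = a * pair f φ := by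
  simp only [pair]
  rw [← Complex.real_smul, ← intervalIntegral.integral_smul]
  congr 1; ext z; rw [smul_comm]

theorem pair_congr_ae {f g : ℝ → ℂ} (h : ∀ᵐ z, z ∈ Ioo (-1 / 2 : ℝ) (1 / 2) → f z = g z)
    (φ : ℝ → ℝ) : pair f φ = pair g φ := by
  refine intervalIntegral.integral_congr_ae ?_
  have h1 : ∀ᵐ z : ℝ, z ≠ 1 / 2 := by simp [ae_iff, measure_singleton]
  filter_upwards [h, h1] with z hz hz1 hm
  rw [uIoc_of_le (by norm_num)] at hm
  rw [hz ⟨hm.1, lt_of_le_of_ne hm.2 hz1⟩]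

theorem pair_deriv {φ : ℝ → ℝ} (hφ : IsTest φ) {f f' : ℝ → ℂ} (hf : ContinuousOn f layer)
    (hd : ∀ z ∈ Ioo (-1 / 2 : ℝ) (1 / 2), HasDerivAt f (f' z) z) (hf' : IL f') :
    pair f (deriv φ) = -pair f' φ := by
  have hle : (-1 / 2 : ℝ) ≤ 1 / 2 := by norm_num
  have := intervalIntegral.integral_smul_deriv_eq_deriv_smul_of_hasDerivAt (u := φ) (v := f)
    (u' := deriv φ) (v' := f') (a := -1 / 2) (b := 1 / 2) hφ.continuous.continuousOn
    (by rwa [uIcc_layer]) (fun x _ => hφ.hasDerivAt x)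
    (by rw [min_eq_left hle, max_eq_right hle]; exact hd)
    (hφ.deriv.continuous.intervalIntegrable _ _) hf'
  rw [hφ.eq_zero (fun h => lt_irrefl _ h.2), hφ.eq_zero (fun h => lt_irrefl _ h.1)] at this
  simp only [pair, this]
  simp

theorem ae_eq_zero_of_pair {f : ℝ → ℂ} (hf : IL f) (h : ∀ φ, IsTest φ → pair f φ = 0) :
    ∀ᵐ z, z ∈ Ioo (-1 / 2 : ℝ) (1 / 2) → f z = 0 := by
  refine isOpen_Ioo.ae_eq_zero_of_integral_contDiff_smul_eq_zero ?_ ?_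
  · rw [IL, intervalIntegrable_iff_integrableOn_Ioo_of_le (by norm_num)] at hf
    exact hf.locallyIntegrableOn
  · intro g hg hc hs
    have hg : IsTest g := ⟨hg, hc, hs⟩
    rw [← h g hg, pair, intervalIntegral.integral_of_le (by norm_num)]
    refine (setIntegral_eq_integral_of_forall_compl_eq_zero fun z hz => ?_).symm
    rw [hg.eq_zero (fun hm => hz (Ioo_subset_Ioc_self hm)), zero_smul]

theorem exists_isTest_integral_one : ∃ ψ, IsTest ψ ∧ ∫ z in (-1 / 2 : ℝ)..(1 / 2), ψ z = 1 := by
  let B : ContDiffBump (0 : ℝ) := ⟨1 / 8, 1 / 4, by norm_num, by norm_num⟩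
  have hs : tsupport (B.normed volume) ⊆ Ioo (-1 / 2 : ℝ) (1 / 2) := by
    rw [B.tsupport_normed_eq, Real.closedBall_eq_Icc]
    exact Icc_subset_Ioo (by norm_num [B]) (by norm_num [B])
  have hB : IsTest (B.normed volume) := ⟨B.contDiff_normed, B.hasCompactSupport_normed, hs⟩
  refine ⟨_, hB, ?_⟩
  refine Eq.trans ?_ (B.integral_normed (μ := volume))
  rw [intervalIntegral.integral_of_le (by norm_num)]
  refine setIntegral_eq_integral_of_forall_compl_eq_zero fun z hz => ?_
  exact hB.eq_zero (fun hm => hz (Ioo_subset_Ioc_self hm))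

/-- A test function with vanishing integral is the derivative of a test function. -/
theorem IsTest.exists_primitive {φ : ℝ → ℝ} (hφ : IsTest φ)
    (h0 : ∫ z in (-1 / 2 : ℝ)..(1 / 2), φ z = 0) : ∃ η, IsTest η ∧ deriv η = φ := by
  have hd (z : ℝ) : HasDerivAt (fun x => ∫ t in (-1 / 2 : ℝ)..x, φ t) (φ z) z :=
    hφ.continuous.integral_hasStrictDerivAt _ _ |>.hasDerivAt
  have hderiv : deriv (fun x => ∫ t in (-1 / 2 : ℝ)..x, φ t) = φ := funext fun z => (hd z).deriv
  have hint (a b : ℝ) : IntervalIntegrable φ volume a b := hφ.continuous.intervalIntegrable _ _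
  -- The primitive vanishes to the left of a trivially, and to the right of b because the total
  -- integral is zero.
  obtain ⟨a, b, ha, hb, hab⟩ : ∃ a b : ℝ, -1 / 2 < a ∧ b < 1 / 2 ∧ tsupport φ ⊆ Icc a b := by
    rcases (tsupport φ).eq_empty_or_nonempty with he | hne
    · exact ⟨0, 0, by norm_num, by norm_num, by simp [he]⟩
    · have hK : IsCompact (tsupport φ) := hφ.2.1
      obtain ⟨a, ha, ha'⟩ := hK.exists_isLeast hne
      obtain ⟨b, hb, hb'⟩ := hK.exists_isGreatest hne
      exact ⟨a, b, (hφ.2.2 ha).1, (hφ.2.2 hb).2, fun z hz => ⟨ha' hz, hb' hz⟩⟩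
  have hz0 : ∀ z, z ∉ Icc a b → φ z = 0 := fun z hz =>
    image_eq_zero_of_notMem_tsupport fun hm => hz (hab hm)
  have hsupp : Function.support (fun x => ∫ t in (-1 / 2 : ℝ)..x, φ t) ⊆ Icc a b := by
    intro x hx
    by_contra hn
    refine hx ?_
    rcases lt_or_ge x a with hxa | hxa
    · refine intervalIntegral.integral_zero_ae (ae_of_all _ fun t ht => ?_)
      rcases le_total (-1 / 2) x with h | h
      · rw [uIoc_of_le h] at ht; exact hz0 t fun hm => by linarith [hm.1, ht.2]
      · rw [uIoc_of_ge h] at ht; exact hz0 t fun hm => by linarith [hm.1, ht.2]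
    · have hxb : b < x := by by_contra hc; exact hn ⟨hxa, not_lt.1 hc⟩
      have : ∫ t in x..(1 / 2), φ t = 0 := by
        refine intervalIntegral.integral_zero_ae (ae_of_all _ fun t ht => ?_)
        rcases le_total x (1 / 2) with h | h
        · rw [uIoc_of_le h] at ht; exact hz0 t fun hm => by linarith [hm.2, ht.1]
        · rw [uIoc_of_ge h] at ht; exact hz0 t fun hm => by linarith [hm.2, ht.1]
      have h2 := intervalIntegral.integral_add_adjacent_intervals (hint (-1 / 2) x) (hint x (1 / 2))
      rw [this, h0, add_zero] at h2
      exact h2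
  have hts : tsupport (fun x => ∫ t in (-1 / 2 : ℝ)..x, φ t) ⊆ Icc a b :=
    closure_minimal hsupp isClosed_Icc
  refine ⟨_, ⟨?_, HasCompactSupport.of_support_subset_isCompact isCompact_Icc hsupp,
    hts.trans (Icc_subset_Ioo ha hb)⟩, hderiv⟩
  rw [contDiff_infty_iff_deriv, hderiv]
  exact ⟨fun z => (hd z).differentiableAt, hφ.1⟩

/-- Subtracting the mean times ψ leaves a test function of integral zero, hence a derivative. A
functional that kills derivatives is thus determined by its value at ψ. -/
theorem IsTest.exists_decomp {ψ φ : ℝ → ℝ} (hψ : IsTest ψ) (hφ : IsTest φ)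
    (h1 : ∫ z in (-1 / 2 : ℝ)..(1 / 2), ψ z = 1) :
    ∃ η, IsTest η ∧ ∀ z, φ z = deriv η z + (∫ z in (-1 / 2 : ℝ)..(1 / 2), φ z) * ψ z := by
  obtain ⟨η, hη, hd⟩ := (hφ.linearComb hψ (∫ z in (-1 / 2 : ℝ)..(1 / 2), φ z)).exists_primitive (by
    refine (intervalIntegral.integral_sub (hφ.continuous.intervalIntegrable _ _)
      ((continuous_const.mul hψ.continuous).intervalIntegrable _ _)).trans ?_
    simp only [Pi.mul_apply]
    rw [intervalIntegral.integral_const_mul, h1, mul_one, sub_self])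
  exact ⟨η, hη, fun z => by rw [hd]; ring⟩

theorem pair_linearComb {f : ℝ → ℂ} (hf : IL f) {φ ψ : ℝ → ℝ} (hφ : IsTest φ) (hψ : IsTest ψ)
    (a : ℝ) : pair f (fun z => φ z + a * ψ z) = pair f φ + a * pair f ψ := by
  simp only [pair, add_smul, mul_smul]
  refine (intervalIntegral.integral_add (hφ.il_smul hf)
    (IntervalIntegrable.smul (hψ.il_smul hf) a)).trans ?_
  simp only [Pi.smul_apply]
  rw [intervalIntegral.integral_smul, Complex.real_smul]

/-- The **du Bois-Reymond lemma**. -/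
theorem ae_const_of_pair_deriv {f : ℝ → ℂ} (hf : IL f)
    (h : ∀ φ, IsTest φ → pair f (deriv φ) = 0) :
    ∃ C, ∀ᵐ z, z ∈ Ioo (-1 / 2 : ℝ) (1 / 2) → f z = C := by
  obtain ⟨ψ, hψ, hψ1⟩ := exists_isTest_integral_one
  refine ⟨pair f ψ, ?_⟩
  have hc : IL fun _ => pair f ψ := intervalIntegrable_const
  have := ae_eq_zero_of_pair (f := fun z => f z - pair f ψ) (hf.sub hc) fun φ hφ => by
    rw [pair_sub hφ hf hc]
    obtain ⟨η, hη, hd⟩ := hψ.exists_decomp hφ hψ1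
    have e1 : pair f φ = (∫ z in (-1 / 2 : ℝ)..(1 / 2), φ z : ℝ) * pair f ψ := by
      conv_lhs => rw [funext hd]
      rw [pair_linearComb hf hη.deriv hψ, h η hη, zero_add]
    have e2 : pair (fun _ => pair f ψ) φ = (∫ z in (-1 / 2 : ℝ)..(1 / 2), φ z : ℝ) * pair f ψ := by
      rw [pair, intervalIntegral.integral_smul_const, Complex.real_smul]
    rw [e1, e2, sub_self]
  filter_upwards [this] with z hz hm using sub_eq_zero.1 (hz hm)

/-- Once the right slope is subtracted, the pairing with every first derivative vanishes, and the
first-order lemma applies. -/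
theorem ae_affine_of_pair_deriv_deriv {f : ℝ → ℂ} (hf : IL f)
    (h : ∀ φ, IsTest φ → pair f (deriv (deriv φ)) = 0) :
    ∃ A B : ℂ, ∀ᵐ z, z ∈ Ioo (-1 / 2 : ℝ) (1 / 2) → f z = A + z • B := by
  obtain ⟨ψ, hψ, hψ1⟩ := exists_isTest_integral_one
  -- The slope is forced: pairing A + z B with ψ' gives -B, since ψ has integral one.
  obtain ⟨B, hB⟩ : ∃ B, B = -pair f (deriv ψ) := ⟨_, rfl⟩
  have hlin : ContinuousOn (fun z : ℝ => z • B) layer := by fun_prop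
  have hl := IL.of_continuousOn hlin
  obtain ⟨A, hA⟩ := ae_const_of_pair_deriv (f := fun z => f z - z • B) (hf.sub hl) fun φ hφ => by
    rw [pair_sub hφ.deriv hf hl]
    obtain ⟨η, hη, hd⟩ := hψ.exists_decomp hφ hψ1
    have hd' : deriv φ = fun z => deriv (deriv η) z
        + (∫ z in (-1 / 2 : ℝ)..(1 / 2), φ z) * deriv ψ z := by
      ext z
      have := (hη.deriv.hasDerivAt z).add
        ((hψ.hasDerivAt z).const_mul (∫ z in (-1 / 2 : ℝ)..(1 / 2), φ z))
      rw [← this.deriv]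
      exact congrArg (fun g => deriv g z) (funext hd)
    have e1 : pair f (deriv φ) = (∫ z in (-1 / 2 : ℝ)..(1 / 2), φ z : ℝ) * pair f (deriv ψ) := by
      rw [hd', pair_linearComb hf hη.deriv.deriv hψ.deriv, h η hη, zero_add]
    have e2 : pair (fun z : ℝ => z • B) (deriv φ)
        = -((∫ z in (-1 / 2 : ℝ)..(1 / 2), φ z : ℝ) * B) := by
      rw [pair_deriv hφ hlin (f' := fun _ => B)
        (fun z _ => by simpa using (hasDerivAt_id z).smul_const B) intervalIntegrable_const, pair,
        intervalIntegral.integral_smul_const, Complex.real_smul]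
    rw [e1, e2, hB]; ring
  exact ⟨A, B, by filter_upwards [hA] with z hz hm using by rw [← hz hm]; ring⟩

/-! ### Primitives and continuous representatives -/

/-- The primitive that vanishes at the left end. -/
noncomputable def prim (g : ℝ → ℂ) (z : ℝ) : ℂ := ∫ t in (-1 / 2 : ℝ)..z, g t

theorem prim_left (g : ℝ → ℂ) : prim g (-1 / 2) = 0 := intervalIntegral.integral_same

theorem continuousOn_prim {g : ℝ → ℂ} (hg : IL g) : ContinuousOn (prim g) layer := by
  have := intervalIntegral.continuousOn_primitive_interval' hg left_mem_uIcc
  rwa [uIcc_layer] at this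

theorem hasDerivAt_prim {g : ℝ → ℂ} (hg : ContinuousOn g layer) {z : ℝ}
    (hz : z ∈ Ioo (-1 / 2 : ℝ) (1 / 2)) : HasDerivAt (prim g) (g z) z := by
  have hn : layer ∈ 𝓝 z := Icc_mem_nhds hz.1 hz.2
  refine intervalIntegral.integral_hasDerivAt_right ?_ ?_ (hg.continuousAt hn)
  · refine (IL.of_continuousOn hg).mono_set ?_
    rw [uIcc_layer, uIcc_of_le hz.1.le]
    exact Icc_subset_Icc_right hz.2.le
  · exact (hg.mono Ioo_subset_Icc_self).stronglyMeasurableAtFilter isOpen_Ioo z hz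

/-- A function whose weak derivative is continuous is continuously differentiable. -/
theorem exists_continuous_rep {f g : ℝ → ℂ} (hf : IL f) (hg : ContinuousOn g layer)
    (h : HasWeakDeriv f g) :
    ∃ F : ℝ → ℂ, ContinuousOn F layer ∧
      (∀ z ∈ Ioo (-1 / 2 : ℝ) (1 / 2), HasDerivAt F (g z) z) ∧
      ∀ᵐ z, z ∈ Ioo (-1 / 2 : ℝ) (1 / 2) → f z = F z := by
  have hgI := IL.of_continuousOn hg
  have hP := continuousOn_prim hgI
  obtain ⟨C, hC⟩ := ae_const_of_pair_deriv (hf.sub (IL.of_continuousOn hP)) fun φ hφ => by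
    have := pair_sub hφ.deriv hf (IL.of_continuousOn hP)
    rw [h φ hφ, pair_deriv hφ hP (fun z => hasDerivAt_prim hg) hgI, sub_self] at this
    exact this
  refine ⟨fun z => prim g z + C, by fun_prop, fun z hz => (hasDerivAt_prim hg hz).add_const C, ?_⟩
  filter_upwards [hC] with z hz hm
  rw [← hz hm]; simp

theorem eqOn_layer_of_ae {E : Type*} [NormedAddCommGroup E] {f g : ℝ → E}
    (hf : ContinuousOn f layer) (hg : ContinuousOn g layer)
    (h : ∀ᵐ z, z ∈ Ioo (-1 / 2 : ℝ) (1 / 2) → f z = g z) : EqOn f g layer := by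
  have h1 : EqOn f g (Ioo (-1 / 2 : ℝ) (1 / 2)) :=
    Measure.eqOn_open_of_ae_eq (μ := volume) ((ae_restrict_iff' measurableSet_Ioo).2 h) isOpen_Ioo
      (hf.mono Ioo_subset_Icc_self) (hg.mono Ioo_subset_Icc_self)
  exact h1.of_subset_closure hf hg Ioo_subset_Icc_self
    (by rw [closure_Ioo (by norm_num)]; rfl)

/-- A continuous function whose weak derivative agrees almost everywhere with a continuous
function is continuously differentiable. -/
theorem hasDerivAt_of_weak {f g G : ℝ → ℂ} (hf : ContinuousOn f layer) (h : HasWeakDeriv f g)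
    (hG : ContinuousOn G layer) (hgG : ∀ᵐ z, z ∈ Ioo (-1 / 2 : ℝ) (1 / 2) → g z = G z) :
    ∀ z ∈ Ioo (-1 / 2 : ℝ) (1 / 2), HasDerivAt f (G z) z := by
  have hw : HasWeakDeriv f G := fun φ hφ => by rw [h φ hφ, pair_congr_ae hgG]
  obtain ⟨F, hF, hF', hae⟩ := exists_continuous_rep (IL.of_continuousOn hf) hG hw
  have he := eqOn_layer_of_ae hf hF hae
  intro z hz
  refine (hF' z hz).congr_of_eventuallyEq ?_
  filter_upwards [Icc_mem_nhds hz.1 hz.2] with x hx using he hx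

/-- A continuous function which agrees almost everywhere with a function tending to `0` at the
right end vanishes there. -/
theorem right_eq_zero_of_tendsto {f F : ℝ → ℂ} (hF : ContinuousOn F layer)
    (h : ∀ᵐ z, z ∈ Ioo (-1 / 2 : ℝ) (1 / 2) → f z = F z)
    (hf : Tendsto f (𝓝[<] (1 / 2)) (𝓝 0)) : F (1 / 2) = 0 := by
  -- Every left neighbourhood of 1/2 has positive measure, so the limit can be taken along points
  -- where f = F.
  have hne : (𝓝[<] (1 / 2 : ℝ) ⊓ ae volume).NeBot := by
    refine inf_neBot_iff.2 fun {s} hs {t} ht => ?_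
    obtain ⟨c, hc, hcs⟩ := (mem_nhdsLT_iff_exists_Ioo_subset).1 hs
    have hpos : volume (Ioo c (1 / 2) ∩ t) ≠ 0 := by
      rw [measure_inter_conull ht]
      simpa using hc
    obtain ⟨x, hx⟩ := nonempty_of_measure_ne_zero hpos
    exact ⟨x, hcs hx.1, hx.2⟩
  have hFt : Tendsto F (𝓝[<] (1 / 2)) (𝓝 (F (1 / 2))) := by
    have h1 : ContinuousWithinAt F layer (1 / 2) := hF _ (by norm_num [layer])
    have h2 := h1.mono (Ioo_subset_Icc_self (a := (-1 / 2 : ℝ)))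
    rwa [ContinuousWithinAt, nhdsWithin_Ioo_eq_nhdsLT (by norm_num)] at h2
  refine tendsto_nhds_unique' hne (hFt.mono_left inf_le_left)
    ((hf.mono_left inf_le_left).congr' ?_)
  have h3 : ∀ᶠ z in 𝓝[<] (1 / 2 : ℝ), z ∈ Ioo (-1 / 2 : ℝ) (1 / 2) :=
    Ioo_mem_nhdsLT (by norm_num)
  filter_upwards [h3.filter_mono inf_le_left, h.filter_mono inf_le_right] with z hz hz'
    using hz' hz

/-! ### Equivalence of weak and classical solutions -/

/-- The coefficient of `D²W` in the operator `D²(ν D²) - D (b D) + c`. -/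
def coeffB (ν : ℝ → ℝ) (k s : ℝ) (z : ℝ) : ℝ := 2 * k ^ 2 * ν z + s

/-- The coefficient of `W` in the operator `D²(ν D²) - D (b D) + c`. -/
noncomputable def coeffC (ν : ℝ → ℝ) (k s : ℝ) (z : ℝ) : ℝ :=
  k ^ 4 * ν z + k ^ 2 * nuSecond ν z + s * k ^ 2

theorem continuousOn_nuSecond {ν : ℝ → ℝ} (hν : ContDiffOn ℝ 2 ν layer) :
    ContinuousOn (nuSecond ν) layer :=
  hν.continuousOn_iteratedDerivWithin le_rfl (uniqueDiffOn_Icc (by norm_num))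

theorem continuousOn_coeffB {ν : ℝ → ℝ} (hν : ContinuousOn ν layer) (k s : ℝ) :
    ContinuousOn (coeffB ν k s) layer := by
  unfold coeffB; fun_prop

theorem continuousOn_coeffC {ν : ℝ → ℝ} (hν : ContDiffOn ℝ 2 ν layer) (k s : ℝ) :
    ContinuousOn (coeffC ν k s) layer := by
  have h1 := hν.continuousOn
  have h2 := continuousOn_nuSecond hν
  unfold coeffC; fun_prop

theorem hasDerivAt_of_contDiffOn {ν : ℝ → ℝ} (hν : ContDiffOn ℝ 2 ν layer) {z : ℝ}
    (hz : z ∈ Ioo (-1 / 2 : ℝ) (1 / 2)) : HasDerivAt ν (derivWithin ν layer z) z :=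
  ((hν.differentiableOn (by norm_num) z (Ioo_subset_Icc_self hz)).hasDerivWithinAt).hasDerivAt
    (Icc_mem_nhds hz.1 hz.2)

/-- In the distributional sense f'' = g' + h. Subtracting the primitive of g + ∫h leaves a function
with zero second derivative, which is affine; its slope is absorbed into N. -/
theorem exists_ae_eq_of_pair_deriv_deriv {f g h : ℝ → ℂ} (hf : IL f) (hg : ContinuousOn g layer)
    (hh : ContinuousOn h layer)
    (he : ∀ φ, IsTest φ → pair f (deriv (deriv φ)) = -pair g (deriv φ) + pair h φ) :
    ∃ M N : ℝ → ℂ, ContinuousOn M layer ∧ ContinuousOn N layer ∧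
      (∀ z ∈ Ioo (-1 / 2 : ℝ) (1 / 2), HasDerivAt M (N z + g z) z) ∧
      (∀ z ∈ Ioo (-1 / 2 : ℝ) (1 / 2), HasDerivAt N (h z) z) ∧
      ∀ᵐ z, z ∈ Ioo (-1 / 2 : ℝ) (1 / 2) → f z = M z := by
  have hN := continuousOn_prim (IL.of_continuousOn hh)
  have hgN : ContinuousOn (fun z => g z + prim h z) layer := hg.add hN
  have hP := continuousOn_prim (IL.of_continuousOn hgN)
  obtain ⟨A, B, hAB⟩ := ae_affine_of_pair_deriv_deriv (hf.sub (IL.of_continuousOn hP))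
    fun φ hφ => by
      have h1 := pair_sub hφ.deriv.deriv hf (IL.of_continuousOn hP)
      rw [he φ hφ, pair_deriv hφ.deriv hP (fun z => hasDerivAt_prim hgN) (IL.of_continuousOn hgN),
        pair_add hφ.deriv (IL.of_continuousOn hg) (IL.of_continuousOn hN),
        pair_deriv hφ hN (fun z => hasDerivAt_prim hh) (IL.of_continuousOn hh)] at h1
      refine h1.trans ?_
      ring
  refine ⟨fun z => prim (fun z => g z + prim h z) z + (A + z • B), fun z => prim h z + B,
    by fun_prop, by fun_prop, fun z hz => ?_, fun z hz => (hasDerivAt_prim hh hz).add_const B, ?_⟩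
  · refine ((hasDerivAt_prim hgN hz).add
      (((hasDerivAt_id z).smul_const B).const_add A)).congr_deriv ?_
    simp only [one_smul]; ring
  · filter_upwards [hAB] with z hz hm
    rw [← hz hm]; simp

/-- A weak solution of the equation for `Θ` is classical. -/
theorem classical_of_weak_theta {κ : ℝ} {Θ Θ₁ W : ℝ → ℂ} (hΘ : InH1 Θ Θ₁)
    (hW : ContinuousOn W layer)
    (he : ∀ φ, IsTest φ → pair Θ₁ (deriv φ) = -pair (fun z => κ • Θ z - W z) φ) :
    ∃ T : ℝ → ℂ, ContinuousOn T layer ∧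
      (∀ z ∈ Ioo (-1 / 2 : ℝ) (1 / 2), HasDerivAt Θ (T z) z) ∧
      ∀ z ∈ Ioo (-1 / 2 : ℝ) (1 / 2), HasDerivAt T (κ • Θ z - W z) z := by
  have hΘc := hΘ.cont
  obtain ⟨T, hT, hT', hae⟩ := exists_continuous_rep hΘ.sq_int.il
    (g := fun z => κ • Θ z - W z) (by fun_prop) he
  exact ⟨T, hT, hasDerivAt_of_weak hΘc hΘ.weak hT hae, hT'⟩

/-- A weak solution of the equation for `W` is classical. -/
theorem classical_of_weak_W {ν b : ℝ → ℝ} (hν : ContinuousOn ν layer)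
    (hpos : ∀ z ∈ layer, 0 < ν z) (hb : ContinuousOn b layer)
    {W₁ W₂ h : ℝ → ℂ} (hW₁ : InH1 W₁ W₂) (hh : ContinuousOn h layer)
    (he : ∀ φ, IsTest φ → pair (fun z => ν z • W₂ z) (deriv (deriv φ))
      = -pair (fun z => b z • W₁ z) (deriv φ) + pair h φ) :
    ∃ M N : ℝ → ℂ, ContinuousOn M layer ∧ ContinuousOn N layer ∧
      (∀ z ∈ Ioo (-1 / 2 : ℝ) (1 / 2), HasDerivAt W₁ ((ν z)⁻¹ • M z) z) ∧
      (∀ z ∈ Ioo (-1 / 2 : ℝ) (1 / 2), HasDerivAt M (N z + b z • W₁ z) z) ∧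
      (∀ z ∈ Ioo (-1 / 2 : ℝ) (1 / 2), HasDerivAt N (h z) z) ∧
      ∀ᵐ z, z ∈ Ioo (-1 / 2 : ℝ) (1 / 2) → W₂ z = (ν z)⁻¹ • M z := by
  have hW₁c := hW₁.cont
  obtain ⟨M, N, hM, hN, hM', hN', hae⟩ := exists_ae_eq_of_pair_deriv_deriv
    (hW₁.sq_int.il.smul hν) (g := fun z => b z • W₁ z) (by fun_prop) hh he
  have hinv : ContinuousOn (fun z => (ν z)⁻¹) layer := hν.inv₀ fun z hz => (hpos z hz).ne'
  have hae' : ∀ᵐ z, z ∈ Ioo (-1 / 2 : ℝ) (1 / 2) → W₂ z = (ν z)⁻¹ • M z := by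
    filter_upwards [hae] with z hz hm
    rw [← hz hm, inv_smul_smul₀ (hpos z (Ioo_subset_Icc_self hm)).ne']
  exact ⟨M, N, hM, hN, hasDerivAt_of_weak hW₁c hW₁.weak (by fun_prop) hae', hM', hN', hae'⟩

theorem InH1.hasDerivAt {f g : ℝ → ℂ} (h : InH1 f g) (hg : ContinuousOn g layer) :
    ∀ z ∈ Ioo (-1 / 2 : ℝ) (1 / 2), HasDerivAt f (g z) z :=
  hasDerivAt_of_weak h.cont h.weak hg (ae_of_all _ fun _ _ => rfl)

/-- Energy identity: (Z Y)' = Y²/ν + d Z² integrates to zero, while the right side is at least m Z².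
-/
theorem eq_zero_of_sturm {ν d : ℝ → ℝ} {Z Y : ℝ → ℝ} {m : ℝ} (hm : 0 < m)
    (hν : ContinuousOn ν layer) (hpos : ∀ z ∈ layer, 0 < ν z) (hd : ContinuousOn d layer)
    (hdm : ∀ z ∈ layer, m ≤ d z) (hZ : ContinuousOn Z layer) (hY : ContinuousOn Y layer)
    (hZ' : ∀ z ∈ Ioo (-1 / 2 : ℝ) (1 / 2), HasDerivAt Z ((ν z)⁻¹ * Y z) z)
    (hY' : ∀ z ∈ Ioo (-1 / 2 : ℝ) (1 / 2), HasDerivAt Y (d z * Z z) z)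
    (hl : Z (-1 / 2) = 0) (hr : Z (1 / 2) = 0) : ∀ z ∈ layer, Z z = 0 := by
  have hinv : ContinuousOn (fun z => (ν z)⁻¹) layer := hν.inv₀ fun z hz => (hpos z hz).ne'
  have hF : ContinuousOn (fun z => (ν z)⁻¹ * Y z * Y z + Z z * (d z * Z z)) layer := by fun_prop
  have hint := intervalIntegral.integral_eq_sub_of_hasDerivAt_of_le (by norm_num) (hZ.mul hY)
    (fun z hz => (hZ' z hz).mul (hY' z hz))
    (ContinuousOn.intervalIntegrable_of_Icc (by norm_num) hF)
  simp only [Pi.mul_apply, hl, hr, zero_mul, sub_zero] at hint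
  intro z hz
  have := eqOn_zero_of_integral_le_zero (g := fun z => Real.sqrt m * Z z) hF (fun z hz => ?_)
    hint.le z hz
  · exact (mul_eq_zero.1 this).resolve_left (Real.sqrt_pos.2 hm).ne'
  · have h1 := inv_pos.2 (hpos z hz)
    have h2 := hdm z hz
    rw [mul_pow, Real.sq_sqrt hm.le]
    nlinarith [mul_nonneg h1.le (mul_self_nonneg (Y z)), mul_self_nonneg (Z z)]

/-- The equation for the vertical vorticity has no nontrivial weak solution. -/
theorem eq_zero_of_weak_Z {ν d : ℝ → ℝ} {m : ℝ} (hm : 0 < m) (hν : ContinuousOn ν layer)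
    (hpos : ∀ z ∈ layer, 0 < ν z) (hd : ContinuousOn d layer)
    (hdm : ∀ z ∈ layer, m ≤ d z) {Z Z₁ : ℝ → ℂ} (hZ : InH10 Z Z₁)
    (he : ∀ φ, IsTest φ → pair (fun z => ν z • Z₁ z) (deriv φ) = -pair (fun z => d z • Z z) φ) :
    ∀ z ∈ layer, Z z = 0 := by
  have hZc := hZ.cont
  obtain ⟨Y, hY, hY', hae⟩ := exists_continuous_rep (hZ.sq_int.il.smul hν)
    (g := fun z => d z • Z z) (by fun_prop) he
  have hinv : ContinuousOn (fun z => (ν z)⁻¹) layer := hν.inv₀ fun z hz => (hpos z hz).ne'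
  have hZ' : ∀ z ∈ Ioo (-1 / 2 : ℝ) (1 / 2), HasDerivAt Z ((ν z)⁻¹ • Y z) z := by
    refine hasDerivAt_of_weak hZc hZ.weak (by fun_prop) ?_
    filter_upwards [hae] with z hz hm
    rw [← hz hm, inv_smul_smul₀ (hpos z (Ioo_subset_Icc_self hm)).ne']
  have key (f : ℂ →L[ℝ] ℝ) : ∀ z ∈ layer, f (Z z) = 0 :=
    eq_zero_of_sturm (Z := fun z => f (Z z)) (Y := fun z => f (Y z)) hm hν hpos hd hdm
      (f.continuous.comp_continuousOn hZc) (f.continuous.comp_continuousOn hY)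
      (fun z hz => (f.hasFDerivAt.comp_hasDerivAt z (hZ' z hz)).congr_deriv (by rw [map_smul, smul_eq_mul]))
      (fun z hz => (f.hasFDerivAt.comp_hasDerivAt z (hY' z hz)).congr_deriv (by rw [map_smul, smul_eq_mul]))
      (by rw [hZ.left, map_zero]) (by rw [hZ.right, map_zero])
  exact fun z hz => Complex.ext (key Complex.reCLM z hz) (key Complex.imCLM z hz)

/-- The pairings in the equation for `W`, collected as those of `D²(ν D²W) - D (b DW) + c W`. -/
theorem weak_W_iff {ν : ℝ → ℝ} (hν : ContDiffOn ℝ 2 ν layer) {Pr k σ R : ℝ} {Θ W W₁ W₂ : ℝ → ℂ}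
    (hΘ : ContinuousOn Θ layer) (hW : ContinuousOn W layer) (hW₁ : InH1 W₁ W₂)
    {φ : ℝ → ℝ} (hφ : IsTest φ) :
    (σ / Pr : ℂ) * (pair W₂ φ - k ^ 2 * pair W φ) =
        -(R * k ^ 2 * pair Θ φ) - k ^ 2 * opP ν k W W₁ φ - opP ν k W₁ W₂ (deriv φ)
          + k ^ 2 * pair (fun z => nuSecond ν z • W z) φ ↔
      pair (fun z => ν z • W₂ z) (deriv (deriv φ))
      = -pair (fun z => coeffB ν k (σ / Pr) z • W₁ z) (deriv φ)
        + pair (fun z => (R * k ^ 2) • Θ z - coeffC ν k (σ / Pr) z • W z) φ := by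
  have hνc := hν.continuousOn
  have h2 := continuousOn_nuSecond hν
  have hW₁c := hW₁.cont
  have I {f : ℝ → ℂ} (hf : ContinuousOn f layer) : IL f := IL.of_continuousOn hf
  have e1 : pair (fun z => coeffB ν k (σ / Pr) z • W₁ z) (deriv φ)
      = 2 * k ^ 2 * pair (fun z => ν z • W₁ z) (deriv φ) + (σ / Pr) * pair W₁ (deriv φ) := by
    have : (fun z => coeffB ν k (σ / Pr) z • W₁ z)
        = fun z => (2 * k ^ 2) • (ν z • W₁ z) + (σ / Pr) • W₁ z := by
      ext z; simp only [coeffB, add_smul, mul_smul]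
    rw [this, pair_add hφ.deriv (I (by fun_prop)) (I (by fun_prop)), pair_smul, pair_smul]
    push_cast; ring
  have e2 : pair (fun z => (R * k ^ 2) • Θ z - coeffC ν k (σ / Pr) z • W z) φ
      = R * k ^ 2 * pair Θ φ - (k ^ 4 * pair (fun z => ν z • W z) φ
        + k ^ 2 * pair (fun z => nuSecond ν z • W z) φ + σ / Pr * k ^ 2 * pair W φ) := by
    have : (fun z => (R * k ^ 2) • Θ z - coeffC ν k (σ / Pr) z • W z)
        = fun z => (R * k ^ 2) • Θ z - (k ^ 4 • (ν z • W z) + k ^ 2 • (nuSecond ν z • W z)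
          + (σ / Pr * k ^ 2) • W z) := by
      ext z; simp only [coeffC, add_smul, mul_smul]
    rw [this, pair_sub hφ (I (by fun_prop)) (I (by fun_prop)),
      pair_add hφ (I (by fun_prop)) (I (by fun_prop)),
      pair_add hφ (I (by fun_prop)) (I (by fun_prop)), pair_smul, pair_smul, pair_smul, pair_smul]
    push_cast; ring
  rw [e1, e2, hW₁.weak φ hφ]
  simp only [opP]
  constructor <;> intro h <;> linear_combination -h

theorem weak_theta_iff {k σ : ℝ} {Θ Θ₁ W : ℝ → ℂ} (hΘ : ContinuousOn Θ layer)
    (hW : ContinuousOn W layer) {φ : ℝ → ℝ} (hφ : IsTest φ) :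
    σ * pair Θ φ = -pair Θ₁ (deriv φ) - k ^ 2 * pair Θ φ + pair W φ ↔
      pair Θ₁ (deriv φ) = -pair (fun z => (k ^ 2 + σ) • Θ z - W z) φ := by
  rw [pair_sub hφ (IL.of_continuousOn (by fun_prop)) (IL.of_continuousOn hW), pair_smul]
  push_cast
  constructor <;> intro h <;> linear_combination h

/-- Weak solutions are classical, and have no vertical vorticity. -/
theorem IsSolution.classical {ν : ℝ → ℝ} (hν : ContDiffOn ℝ 2 ν layer)
    (hpos : ∀ z ∈ layer, 0 < ν z) {Pr k σ R : ℝ} (hPr : 0 < Pr) (hk : k ≠ 0) (hσ : 0 ≤ σ)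
    {Z Θ W : ℝ → ℂ} (h : IsSolution ν Pr k σ R Z Θ W) :
    (∀ z ∈ layer, Z z = 0) ∧ ∃ W₁ M N T, ClassicalSol ν (coeffB ν k (σ / Pr))
      (coeffC ν k (σ / Pr)) (k ^ 2 + σ) (R * k ^ 2) W W₁ M N Θ T := by
  obtain ⟨Z₁, Θ₁, W₁, W₂, hZ, hΘ, hW, he⟩ := h
  have hνc := hν.continuousOn
  have hZc := hZ.cont
  have hΘc := hΘ.cont
  have hWc := hW.memW.cont
  have hW₁c := hW.memDW.cont
  have hCc := continuousOn_coeffC hν k (σ / Pr)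
  obtain ⟨n₀, hn₀, hn₀'⟩ := exists_pos_lower_bound hνc hpos
  constructor
  -- The term k² ν keeps the potential positive even for σ = 0, because k ≠ 0.
  · refine eq_zero_of_weak_Z (d := fun z => σ / Pr + k ^ 2 * ν z) (m := k ^ 2 * n₀)
      (by positivity) hνc hpos (by fun_prop) (fun z hz => ?_) hZ fun φ hφ => ?_
    · have h1 : k ^ 2 * n₀ ≤ k ^ 2 * ν z := by gcongr; exact hn₀' z hz
      have h2 : 0 ≤ σ / Pr := by positivity
      linarith
    · have h1 := (he φ hφ).1
      have e : (fun z => (σ / Pr + k ^ 2 * ν z) • Z z)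
          = fun z => (σ / Pr) • Z z + k ^ 2 • (ν z • Z z) := by
        ext z; simp only [add_smul, mul_smul]
      rw [e, pair_add hφ (IL.of_continuousOn (by fun_prop)) (IL.of_continuousOn (by fun_prop)),
        pair_smul, pair_smul]
      simp only [opP] at h1
      push_cast
      linear_combination h1
  · obtain ⟨T, hT, hΘT, hT'⟩ := classical_of_weak_theta hΘ.toInH1 hWc
      fun φ hφ => (weak_theta_iff hΘc hWc hφ).1 (he φ hφ).2.1
    obtain ⟨M, N, hM, hN, hW₁', hM', hN', hae⟩ := classical_of_weak_W hνc hpos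
      (continuousOn_coeffB hνc k (σ / Pr)) hW.memDW
      (h := fun z => (R * k ^ 2) • Θ z - coeffC ν k (σ / Pr) z • W z) (by fun_prop)
      fun φ hφ => (weak_W_iff hν hΘc hWc hW.memDW hφ).1 (he φ hφ).2.2
    have hinv : ContinuousOn (fun z => (ν z)⁻¹) layer := hνc.inv₀ fun z hz => (hpos z hz).ne'
    have hrM := right_eq_zero_of_tendsto (F := fun z => (ν z)⁻¹ • M z) (by fun_prop) hae hW.freeslip
    have hν₁ : (ν (1 / 2))⁻¹ ≠ 0 := (inv_pos.2 (hpos _ (by norm_num [layer]))).ne'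
    exact ⟨W₁, M, N, T, hWc, hW₁c, hM, hN, hΘc, hT, hW.memW.hasDerivAt hW₁c, hW₁', hM', hN', hΘT,
      hT', hW.left, hW.noslip, hΘ.left, hW.right, (smul_eq_zero.1 hrM).resolve_left hν₁, hΘ.right⟩

theorem InH1.of_hasDerivAt {f g : ℝ → ℂ} (hf : ContinuousOn f layer) (hg : ContinuousOn g layer)
    (h : ∀ z ∈ Ioo (-1 / 2 : ℝ) (1 / 2), HasDerivAt f (g z) z) : InH1 f g :=
  ⟨hf, fun _ hφ => pair_deriv hφ hf h (IL.of_continuousOn hg), InL2.of_continuousOn hg⟩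

/-- Classical solutions are weak solutions. -/
theorem ClassicalSol.isSolution {ν : ℝ → ℝ} (hν : ContDiffOn ℝ 2 ν layer)
    (hpos : ∀ z ∈ layer, 0 < ν z) {Pr k σ R : ℝ} {W W₁ M N Θ T : ℝ → ℂ}
    (h : ClassicalSol ν (coeffB ν k (σ / Pr)) (coeffC ν k (σ / Pr)) (k ^ 2 + σ) (R * k ^ 2)
      W W₁ M N Θ T) : IsSolution ν Pr k σ R 0 Θ W := by
  have hνc := hν.continuousOn
  have hinv : ContinuousOn (fun z => (ν z)⁻¹) layer := hνc.inv₀ fun z hz => (hpos z hz).ne'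
  have hBc := continuousOn_coeffB hνc k (σ / Pr)
  have hCc := continuousOn_coeffC hν k (σ / Pr)
  obtain ⟨cW, cW₁, cM, cN, cΘ, cT, dW, dW₁, dM, dN, dΘ, dT, lW, lW₁, lΘ, rW, rM, rΘ⟩ := h
  have cW₂ : ContinuousOn (fun z => (ν z)⁻¹ • M z) layer := by fun_prop
  have hW₁ : InH1 W₁ (fun z => (ν z)⁻¹ • M z) := .of_hasDerivAt cW₁ cW₂ dW₁
  refine ⟨0, T, W₁, fun z => (ν z)⁻¹ • M z, ⟨.of_hasDerivAt continuousOn_const continuousOn_const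
    fun z _ => hasDerivAt_const z 0, rfl, rfl⟩, ⟨.of_hasDerivAt cΘ cT dΘ, lΘ, rΘ⟩,
    ⟨.of_hasDerivAt cW cW₁ dW, hW₁, lW, rW, lW₁, ?_⟩, fun φ hφ => ⟨?_, ?_, ?_⟩⟩
  · have h1 : ContinuousWithinAt (fun z => (ν z)⁻¹ • M z) layer (1 / 2) :=
      cW₂ _ (by norm_num [layer])
    have h2 := h1.mono (Ioo_subset_Icc_self (a := (-1 / 2 : ℝ)))
    rwa [ContinuousWithinAt, nhdsWithin_Ioo_eq_nhdsLT (by norm_num), rM, smul_zero] at h2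
  · simp [opP, pair]
  · exact (weak_theta_iff cΘ cW hφ).2 (pair_deriv hφ cT dT (IL.of_continuousOn (by fun_prop)))
  · refine (weak_W_iff hν cΘ cW hW₁ hφ).2 ?_
    have e : pair (fun z => ν z • ((ν z)⁻¹ • M z)) (deriv (deriv φ)) = pair M (deriv (deriv φ)) :=
      pair_congr_ae (ae_of_all _ fun z hz => by
        rw [smul_inv_smul₀ (hpos z (Ioo_subset_Icc_self hz)).ne']) _
    rw [e, pair_deriv hφ.deriv cM dM (IL.of_continuousOn (by fun_prop)),
      pair_add hφ.deriv (IL.of_continuousOn cN) (IL.of_continuousOn (by fun_prop)),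
      pair_deriv hφ cN dN (IL.of_continuousOn (by fun_prop))]
    ring

/-! ### Compact positive operators and coercive pencils -/

section Spectral

open Module.End

variable {E F : Type*} [NormedAddCommGroup E] [InnerProductSpace ℂ E] [CompleteSpace E]
  [NormedAddCommGroup F] [InnerProductSpace ℂ F] [CompleteSpace F]

/-- An operator bounded below is a closed embedding, so the preimage of a compact set is a compact
neighbourhood of 0, and Riesz's theorem applies. -/
theorem finiteDimensional_of_compact_of_antilipschitz {T : E →L[ℂ] E} (hT : IsCompactOperator T)
    {K : NNReal} (hK : AntilipschitzWith K T) : FiniteDimensional ℂ E := by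
  rw [← isCompactOperator_id_iff_finiteDimensional]
  obtain ⟨S, hS, hS'⟩ := hT
  exact ⟨_, (hK.isClosedEmbedding T.uniformContinuous).isCompact_preimage hS, hS'⟩

/-- If the eigenvalues of a compact symmetric operator are bounded away from zero, then so is
the operator. -/
theorem le_norm_apply_of_eigenvalues {T : E →L[ℂ] E} (hT : IsCompactOperator T)
    (hs : (T : E →ₗ[ℂ] E).IsSymmetric) {ε : ℝ} (hε : 0 ≤ ε)
    (h : ∀ μ, HasEigenvalue (T : Module.End ℂ E) μ → ε ≤ ‖μ‖) (x : E) : ε * ‖x‖ ≤ ‖T x‖ := by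
  -- By density of the span of the eigenspaces, the bound need only be checked on finite sums of
  -- eigenvectors, where it follows from Pythagoras.
  have hd : (⨆ μ, eigenspace (T : Module.End ℂ E) μ).topologicalClosure = ⊤ := by
    rw [Submodule.topologicalClosure_eq_top_iff]
    exact ContinuousLinearMap.orthogonalComplement_iSup_eigenspaces_eq_bot hT hs
  have hx : x ∈ closure ((⨆ μ, eigenspace (T : Module.End ℂ E) μ : Submodule ℂ E) : Set E) := by
    rw [← Submodule.topologicalClosure_coe, hd]; trivial
  have hclosed : IsClosed {x : E | ε * ‖x‖ ≤ ‖T x‖} :=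
    isClosed_le (by fun_prop) (by fun_prop)
  refine closure_minimal (fun y hy => ?_) hclosed hx
  obtain ⟨f, hf, rfl⟩ := (Submodule.mem_iSup_iff_exists_finsupp _ _).1 hy
  have hO := hs.orthogonalFamily_eigenspaces
  have e1 := hO.norm_sum (fun μ => ⟨f μ, hf μ⟩) f.support
  have e2 := hO.norm_sum (fun μ => μ • ⟨f μ, hf μ⟩) f.support
  simp only [Submodule.coe_subtypeₗᵢ, Submodule.subtype_apply, Submodule.coe_norm,
    Submodule.coe_smul] at e1 e2
  have e3 : T (f.sum fun _ x => x) = ∑ μ ∈ f.support, μ • f μ := by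
    rw [Finsupp.sum, map_sum]
    exact Finset.sum_congr rfl fun μ _ => mem_eigenspace_iff.1 (hf μ)
  refine le_of_sq_le_sq ?_ (norm_nonneg _)
  rw [e3, mul_pow, e2, Finsupp.sum, e1, Finset.mul_sum]
  refine Finset.sum_le_sum fun μ hμ => ?_
  rw [norm_smul, mul_pow]
  have : ε ≤ ‖μ‖ := h μ (hasEigenvalue_of_hasEigenvector ⟨hf μ, Finsupp.mem_support_iff.1 hμ⟩)
  gcongr

/-- A positive definite compact operator on an infinite-dimensional space has arbitrarily small
positive eigenvalues. -/
theorem exists_small_eigenvalue {T : E →L[ℂ] E} (hT : IsCompactOperator T)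
    (hs : (T : E →ₗ[ℂ] E).IsSymmetric) (hpos : ∀ x, x ≠ 0 → 0 < (inner ℂ (T x) x).re)
    (hinf : ¬FiniteDimensional ℂ E) {ε : ℝ} (hε : 0 < ε) :
    ∃ μ : ℝ, 0 < μ ∧ μ < ε ∧ ∃ x, x ≠ 0 ∧ T x = (μ : ℂ) • x := by
  -- Without eigenvalues below ε the operator would be bounded below by ε, which compactness forbids
  -- in infinite dimension.
  by_contra! H
  refine hinf (finiteDimensional_of_compact_of_antilipschitz hT
    (K := Real.toNNReal ε⁻¹) (T.antilipschitz_of_bound fun x => ?_))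
  rw [Real.coe_toNNReal _ (by positivity), inv_mul_eq_div, le_div_iff₀ hε, mul_comm]
  refine le_norm_apply_of_eigenvalues hT hs hε.le (fun μ hμ => ?_) x
  obtain ⟨v, hv⟩ := hμ.exists_hasEigenvector
  have hv1 : T v = μ • v := hv.apply_eq_smul
  have hreal : ((μ.re : ℝ) : ℂ) = μ := Complex.conj_eq_iff_re.1 (hs.conj_eigenvalue_eq_self hμ)
  have h1 := hpos v hv.2
  rw [hv1, ← hreal, inner_smul_left, Complex.conj_ofReal, Complex.re_ofReal_mul] at h1
  have h2 : 0 ≤ (inner ℂ v v).re := inner_self_nonneg (𝕜 := ℂ)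
  have h3 : 0 < μ.re := pos_of_mul_pos_left h1 h2
  by_contra hlt
  rw [← hreal, Complex.norm_real, Real.norm_eq_abs, abs_of_pos h3, not_le] at hlt
  exact H μ.re h3 hlt v hv.2 (by rw [hreal, hv1])

/-- A coercive symmetric operator has an invertible symmetric square root. -/
theorem exists_sqrt_of_coercive {B : E →L[ℂ] E} (hB : (B : E →ₗ[ℂ] E).IsSymmetric) {δ : ℝ}
    (hδ : 0 < δ) (hc : ∀ x, δ * ‖x‖ ^ 2 ≤ (inner ℂ (B x) x).re) :
    ∃ S R : E →L[ℂ] E, (S : E →ₗ[ℂ] E).IsSymmetric ∧ (∀ x, S (S x) = B x) ∧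
      (∀ x, S (R x) = x) ∧ ∀ x, R (S x) = x := by
  have hpos : 0 ≤ B := by
    rw [ContinuousLinearMap.nonneg_iff_isPositive, ContinuousLinearMap.isPositive_def]
    exact ⟨hB, fun x => (by positivity : 0 ≤ δ * ‖x‖ ^ 2).trans (hc x)⟩
  have hu : IsUnit B := by
    refine B.isUnit_of_forall_le_norm_inner_map (c := Real.toNNReal δ) (Real.toNNReal_pos.2 hδ) fun x => ?_
    rw [Real.coe_toNNReal _ hδ.le, mul_comm]
    exact (hc x).trans (Complex.re_le_norm _)
  have hus : IsUnit (CFC.sqrt B) := (CFC.isUnit_sqrt_iff B hpos).2 hu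
  obtain ⟨U, hU⟩ := hus
  refine ⟨CFC.sqrt B, (↑U⁻¹ : E →L[ℂ] E), ?_, fun x => ?_, fun x => ?_, fun x => ?_⟩
  · have h0 : 0 ≤ CFC.sqrt B := CFC.sqrt_nonneg B
    exact ((ContinuousLinearMap.nonneg_iff_isPositive _).1 h0).isSymmetric
  · exact congrArg (fun A : E →L[ℂ] E => A x) (CFC.sqrt_mul_sqrt_self B hpos)
  · rw [← hU]; exact congrArg (fun A : E →L[ℂ] E => A x) U.mul_inv
  · rw [← hU]; exact congrArg (fun A : E →L[ℂ] E => A x) U.inv_mul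

/-- The eigenvalues of the pencil `B - l C` are unbounded above. -/
theorem exists_large_pencil_eigenvalue {B C : E →L[ℂ] E} (hB : (B : E →ₗ[ℂ] E).IsSymmetric)
    {δ : ℝ} (hδ : 0 < δ) (hc : ∀ x, δ * ‖x‖ ^ 2 ≤ (inner ℂ (B x) x).re)
    (hC : IsCompactOperator C) (hCs : (C : E →ₗ[ℂ] E).IsSymmetric)
    (hpos : ∀ x, x ≠ 0 → 0 < (inner ℂ (C x) x).re) (hinf : ¬FiniteDimensional ℂ E) (Λ : ℝ) :
    ∃ l : ℝ, Λ < l ∧ ∃ x, x ≠ 0 ∧ B x = (l : ℂ) • C x := by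
  obtain ⟨S, R, hS, hSS, hSR, hRS⟩ := exists_sqrt_of_coercive hB hδ hc
  have hR : (R : E →ₗ[ℂ] E).IsSymmetric := fun x y => by
    have := hS (R x) (R y)
    simp only [ContinuousLinearMap.coe_coe, hSR] at this ⊢
    exact this.symm
  have hTs : ((R ∘L C ∘L R : E →L[ℂ] E) : E →ₗ[ℂ] E).IsSymmetric := fun x y => by
    have h1 := hR (C (R x)) y
    have h2 := hCs (R x) (R y)
    have h3 := hR x (C (R y))
    simp only [ContinuousLinearMap.coe_coe, ContinuousLinearMap.comp_apply] at h1 h2 h3 ⊢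
    rw [h1, h2, h3]
  have hTp (x : E) (hx : x ≠ 0) : 0 < (inner ℂ ((R ∘L C ∘L R) x) x).re := by
    have h1 := hR (C (R x)) x
    simp only [ContinuousLinearMap.coe_coe, ContinuousLinearMap.comp_apply] at h1 ⊢
    rw [h1]
    exact hpos _ fun h => hx (by rw [← hSR x, h, map_zero])
  -- With B = S² and R = S⁻¹ the pencil becomes R C R x = μ x, where l = 1/μ and the eigenvector is
  -- R x; μ < 1/(|Λ| + 1) gives l > Λ.
  obtain ⟨μ, hμ, hμ', x, hx, hTx⟩ := exists_small_eigenvalue (T := R ∘L C ∘L R)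
    ((hC.comp_clm R).clm_comp R) hTs hTp hinf (ε := (|Λ| + 1)⁻¹) (by positivity)
  refine ⟨μ⁻¹, ?_, R x, fun h => hx ?_, ?_⟩
  · have := (lt_inv_comm₀ hμ (by positivity)).1 hμ'
    linarith [le_abs_self Λ]
  · rw [← hSR x, h, map_zero]
  · have h1 : C (R x) = (μ : ℂ) • S x := by
      have := congrArg S hTx
      simpa only [ContinuousLinearMap.comp_apply, hSR, map_smul] using this
    rw [h1, ← hSS, hSR, Complex.ofReal_inv, inv_smul_smul₀ (by exact_mod_cast hμ.ne')]

/-- Eigenvalues of the system `B u = l G† v`, `D v = G u` with a compact injective coupling. -/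
theorem exists_large_coupled_eigenvalue {B : E →L[ℂ] E} {D : F →L[ℂ] F} {G : E →L[ℂ] F}
    (hB : (B : E →ₗ[ℂ] E).IsSymmetric) {δ : ℝ} (hδ : 0 < δ)
    (hc : ∀ x, δ * ‖x‖ ^ 2 ≤ (inner ℂ (B x) x).re)
    (hD : (D : F →ₗ[ℂ] F).IsSymmetric) {δ' : ℝ} (hδ' : 0 < δ')
    (hc' : ∀ x, δ' * ‖x‖ ^ 2 ≤ (inner ℂ (D x) x).re)
    (hG : IsCompactOperator G) (hGi : ∀ x, G x = 0 → x = 0) (hinf : ¬FiniteDimensional ℂ E)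
    (Λ : ℝ) :
    ∃ l : ℝ, Λ < l ∧ ∃ u v, u ≠ 0 ∧ D v = G u ∧ B u = (l : ℂ) • G.adjoint v := by
  obtain ⟨S, R, hS, hSS, hSR, hRS⟩ := exists_sqrt_of_coercive hD hδ' hc'
  have hR (x y : F) : inner ℂ (R x) y = inner ℂ x (R y) := by
    have := hS (R x) (R y)
    simp only [ContinuousLinearMap.coe_coe, hSR] at this
    exact this.symm
  have hCs : ((G.adjoint ∘L R ∘L R ∘L G : E →L[ℂ] E) : E →ₗ[ℂ] E).IsSymmetric := fun x y => by
    simp only [ContinuousLinearMap.coe_coe, ContinuousLinearMap.comp_apply,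
      ContinuousLinearMap.adjoint_inner_left, ContinuousLinearMap.adjoint_inner_right, hR]
  have hCp (x : E) (hx : x ≠ 0) : 0 < (inner ℂ ((G.adjoint ∘L R ∘L R ∘L G) x) x).re := by
    simp only [ContinuousLinearMap.comp_apply, ContinuousLinearMap.adjoint_inner_left]
    rw [hR]
    have h0 : R (G x) ≠ 0 := fun h => hx (hGi x (by rw [← hSR (G x), h, map_zero]))
    have h1 := inner_self_eq_norm_sq (𝕜 := ℂ) (R (G x))
    exact (by positivity : (0 : ℝ) < ‖R (G x)‖ ^ 2).trans_eq h1.symm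
  obtain ⟨l, hl, u, hu, he⟩ := exists_large_pencil_eigenvalue (B := B)
    (C := G.adjoint ∘L R ∘L R ∘L G) hB hδ hc
    (hG.clm_comp (G.adjoint ∘L R ∘L R)) hCs hCp hinf Λ
  -- Here v = D⁻¹ G u, as R is the inverse square root of D.
  exact ⟨l, hl, u, R (R (G u)), hu, by rw [← hSS, hSR, hSR], he⟩

end Spectral

/-! ### The Volterra operator on L² and its compactness -/

instance isFiniteMeasure_layer : IsFiniteMeasure (volume.restrict layer) := ⟨by simp [layer]⟩

/-- The Hilbert space `L²(-1/2, 1/2)`. -/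
abbrev HL : Type := Lp ℂ 2 (volume.restrict layer)

theorem ae_Ioo_of_ae_layer {P : ℝ → Prop} (h : ∀ᵐ z ∂volume.restrict layer, P z) :
    ∀ᵐ z, z ∈ Ioo (-1 / 2 : ℝ) (1 / 2) → P z := by
  filter_upwards [(ae_restrict_iff' measurableSet_Icc).1 h] with z hz hm
    using hz (Ioo_subset_Icc_self hm)

theorem ae_layer_of_ae_Ioo {P : ℝ → Prop} (h : ∀ᵐ z, z ∈ Ioo (-1 / 2 : ℝ) (1 / 2) → P z) :
    ∀ᵐ z ∂volume.restrict layer, P z := by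
  rw [layer, ← restrict_Ioo_eq_restrict_Icc]
  exact (ae_restrict_iff' measurableSet_Ioo).2 h

theorem inL2_coe (f : HL) : InL2 f := Lp.memLp f

theorem il_coe (f : HL) : IL f := (inL2_coe f).il

/-- The class of a continuous function. -/
noncomputable def cl (f : ℝ → ℂ) (hf : ContinuousOn f layer) : HL :=
  MemLp.toLp f (InL2.of_continuousOn hf)

theorem cl_ae {f : ℝ → ℂ} (hf : ContinuousOn f layer) :
    ∀ᵐ z, z ∈ Ioo (-1 / 2 : ℝ) (1 / 2) → cl f hf z = f z :=
  ae_Ioo_of_ae_layer (MemLp.coeFn_toLp _)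

theorem cl_congr {f g : ℝ → ℂ} (hf : ContinuousOn f layer) (hg : ContinuousOn g layer)
    (h : EqOn f g layer) : cl f hf = cl g hg :=
  MemLp.toLp_congr _ _ ((ae_restrict_iff' measurableSet_Icc).2 (ae_of_all _ h))

theorem cl_add {f g : ℝ → ℂ} (hf : ContinuousOn f layer) (hg : ContinuousOn g layer) :
    cl (f + g) (hf.add hg) = cl f hf + cl g hg :=
  MemLp.toLp_add (InL2.of_continuousOn hf) (InL2.of_continuousOn hg)

theorem cl_smul {f : ℝ → ℂ} (a : ℂ) (hf : ContinuousOn f layer) :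
    cl (a • f) (hf.const_smul a) = a • cl f hf :=
  MemLp.toLp_const_smul a (InL2.of_continuousOn hf)

theorem prim_congr_ae {f g : ℝ → ℂ} (h : ∀ᵐ z, z ∈ Ioo (-1 / 2 : ℝ) (1 / 2) → f z = g z) {z : ℝ}
    (hz : z ∈ layer) : prim f z = prim g z := by
  refine intervalIntegral.integral_congr_ae ?_
  have h1 : ∀ᵐ t : ℝ, t ≠ 1 / 2 := by simp [ae_iff, measure_singleton]
  filter_upwards [h, h1] with t ht ht1 hm
  rw [uIoc_of_le hz.1] at hm
  exact ht ⟨hm.1, lt_of_le_of_ne (hm.2.trans hz.2) ht1⟩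

theorem IL.mono {f : ℝ → ℂ} (hf : IL f) {x y : ℝ} (hx : x ∈ layer) (hy : y ∈ layer) :
    IntervalIntegrable f volume x y :=
  hf.mono_set (by rw [uIcc_layer]; exact ordConnected_Icc.uIcc_subset hx hy)

theorem left_mem_layer : (-1 / 2 : ℝ) ∈ layer := by norm_num [layer]

theorem right_mem_layer : (1 / 2 : ℝ) ∈ layer := by norm_num [layer]

theorem inner_indicator_Ioc (f : HL) {x y : ℝ} (hx : x ∈ layer) (hy : y ∈ layer) (hxy : x ≤ y) :
    inner ℂ (indicatorConstLp 2 (measurableSet_Ioc (a := x) (b := y))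
      (measure_ne_top (volume.restrict layer) _) (1 : ℂ)) f = prim f y - prim f x := by
  have hsub : Ioc x y ⊆ layer := fun t ht => ⟨hx.1.trans ht.1.le, ht.2.trans hy.2⟩
  rw [L2.inner_indicatorConstLp_one, prim, prim,
    intervalIntegral.integral_interval_sub_left ((il_coe f).mono left_mem_layer hy)
      ((il_coe f).mono left_mem_layer hx), intervalIntegral.integral_of_le hxy,
    Measure.restrict_restrict measurableSet_Ioc, inter_eq_left.2 hsub]

/-- Cauchy-Schwarz against the indicator of (x, y]. This Hölder estimate is what makes the Volterra
operator compact. -/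
theorem norm_prim_sub_le (f : HL) {x y : ℝ} (hx : x ∈ layer) (hy : y ∈ layer) (hxy : x ≤ y) :
    ‖prim f y - prim f x‖ ≤ Real.sqrt (y - x) * ‖f‖ := by
  have hsub : Ioc x y ⊆ layer := fun t ht => ⟨hx.1.trans ht.1.le, ht.2.trans hy.2⟩
  rw [← inner_indicator_Ioc f hx hy hxy]
  refine (norm_inner_le_norm _ _).trans ?_
  gcongr
  refine (norm_indicatorConstLp (by norm_num) (by norm_num)).le.trans ?_
  rw [measureReal_restrict_apply measurableSet_Ioc, inter_eq_left.2 hsub,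
    Real.volume_real_Ioc_of_le hxy, norm_one, one_mul, Real.sqrt_eq_rpow]
  norm_num

theorem norm_prim_le (f : HL) {x : ℝ} (hx : x ∈ layer) : ‖prim f x‖ ≤ ‖f‖ := by
  have h := norm_prim_sub_le f left_mem_layer hx hx.1
  rw [prim_left, sub_zero] at h
  refine h.trans (mul_le_of_le_one_left (norm_nonneg _) ?_)
  exact (Real.sqrt_le_sqrt (by linarith [hx.2])).trans Real.sqrt_one.le

theorem measureUnivNNReal_layer : measureUnivNNReal (volume.restrict layer) = 1 := by
  simp [measureUnivNNReal, layer]; norm_num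

theorem norm_le_of_bound {f : HL} {C : ℝ} (hC : 0 ≤ C)
    (h : ∀ᵐ z ∂volume.restrict layer, ‖f z‖ ≤ C) : ‖f‖ ≤ C := by
  simpa [measureUnivNNReal_layer] using Lp.norm_le_of_ae_bound hC h

/-- The Volterra operator `f ↦ ∫_{-1/2}^z f` on `L²`. -/
noncomputable def volterra : HL →L[ℂ] HL :=
  LinearMap.mkContinuous
    { toFun := fun f => cl (prim f) (continuousOn_prim (il_coe f))
      map_add' := fun f g => by
        rw [← cl_add]
        refine cl_congr _ ((continuousOn_prim (il_coe f)).add (continuousOn_prim (il_coe g)))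
          fun z hz => ?_
        rw [prim_congr_ae (ae_Ioo_of_ae_layer (Lp.coeFn_add f g)) hz]
        exact intervalIntegral.integral_add ((il_coe f).mono left_mem_layer hz)
          ((il_coe g).mono left_mem_layer hz)
      map_smul' := fun a f => by
        rw [RingHom.id_apply, ← cl_smul]
        refine cl_congr _ ((continuousOn_prim (il_coe f)).const_smul a) fun z hz => ?_
        rw [prim_congr_ae (ae_Ioo_of_ae_layer (Lp.coeFn_smul a f)) hz]
        exact intervalIntegral.integral_smul a _ }
    1 fun f => by
      rw [one_mul]
      refine norm_le_of_bound (norm_nonneg _) ?_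
      filter_upwards [MemLp.coeFn_toLp (InL2.of_continuousOn (continuousOn_prim (il_coe f))),
        ae_restrict_mem measurableSet_Icc] with z hz hm
      exact (congrArg norm hz).le.trans (norm_prim_le f hm)

theorem volterra_apply (f : HL) : volterra f = cl (prim f) (continuousOn_prim (il_coe f)) := rfl

theorem volterra_ae (f : HL) :
    ∀ᵐ z, z ∈ Ioo (-1 / 2 : ℝ) (1 / 2) → volterra f z = prim f z :=
  cl_ae (continuousOn_prim (il_coe f))

theorem prim_eq_of_hasDerivAt {h h' : ℝ → ℂ} (hc : ContinuousOn h layer)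
    (hc' : ContinuousOn h' layer) (hd : ∀ z ∈ Ioo (-1 / 2 : ℝ) (1 / 2), HasDerivAt h (h' z) z)
    {z : ℝ} (hz : z ∈ layer) : prim h' z = h z - h (-1 / 2) :=
  intervalIntegral.integral_eq_sub_of_hasDerivAt_of_le hz.1 (hc.mono (Icc_subset_Icc_right hz.2))
    (fun x hx => hd x ⟨hx.1, hx.2.trans_le hz.2⟩) ((IL.of_continuousOn hc').mono left_mem_layer hz)

theorem volterra_cl {h h' : ℝ → ℂ} (hc : ContinuousOn h layer) (hc' : ContinuousOn h' layer)
    (hd : ∀ z ∈ Ioo (-1 / 2 : ℝ) (1 / 2), HasDerivAt h (h' z) z) (h0 : h (-1 / 2) = 0) :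
    volterra (cl h' hc') = cl h hc := by
  rw [volterra_apply]
  refine cl_congr _ _ fun z hz => ?_
  rw [prim_congr_ae (cl_ae hc') hz, prim_eq_of_hasDerivAt hc hc' hd hz, h0, sub_zero]

theorem coeFn_finsetSum {ι : Type*} (s : Finset ι) (g : ι → HL) :
    ∀ᵐ z ∂volume.restrict layer, (∑ i ∈ s, g i : HL) z = ∑ i ∈ s, g i z := by
  classical
  induction s using Finset.induction_on with
  | empty =>
    filter_upwards [Lp.coeFn_zero ℂ 2 (volume.restrict layer)] with z hz using by simpa using hz
  | insert i s hi ih =>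
    rw [Finset.sum_insert hi]
    filter_upwards [ih, Lp.coeFn_add (g i) (∑ i ∈ s, g i)] with z h1 h2
    rw [h2, Pi.add_apply, h1, Finset.sum_insert hi]

/-- The step function approximation of the Volterra operator with `n` steps. -/
noncomputable def volterraStep (n : ℕ) : HL →L[ℂ] HL :=
  ∑ i ∈ Finset.range n,
    (innerSL ℂ (indicatorConstLp 2 (measurableSet_Ioc (a := (-1 / 2 : ℝ)) (b := -1 / 2 + i / n))
      (measure_ne_top (volume.restrict layer) _) (1 : ℂ))).smulRight
    (indicatorConstLp 2 (measurableSet_Ioc (a := (-1 / 2 + i / n : ℝ)) (b := -1 / 2 + (i + 1) / n))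
      (measure_ne_top (volume.restrict layer) _) (1 : ℂ))

theorem isCompactOperator_volterraStep (n : ℕ) : IsCompactOperator (volterraStep n) := by
  refine Submodule.sum_mem (compactOperator (RingHom.id ℂ) HL HL) fun i _ => ?_
  exact (isCompactOperator_of_locallyCompactSpace_dom (innerSL ℂ _)).clm_comp
    (ContinuousLinearMap.toSpanSingleton ℂ _)

/-- The cells are closed on the right, so the index is the ceiling of (z + 1/2) n, minus one. -/
theorem exists_step {n : ℕ} (hn : 0 < n) {z : ℝ} (hz : z ∈ Ioo (-1 / 2 : ℝ) (1 / 2)) :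
    ∃ j ∈ Finset.range n, ∀ i : ℕ,
      z ∈ Ioc (-1 / 2 + i / n : ℝ) (-1 / 2 + (i + 1) / n) ↔ i = j := by
  have hn' : (0 : ℝ) < n := by exact_mod_cast hn
  have hpos : 0 < (z + 1 / 2) * n := mul_pos (by linarith [hz.1]) hn'
  have hlt : (z + 1 / 2) * n < n := by nlinarith [hz.2]
  have hiff (i : ℕ) : z ∈ Ioc (-1 / 2 + i / n : ℝ) (-1 / 2 + (i + 1) / n) ↔
      ⌈(z + 1 / 2) * n⌉₊ = i + 1 := by
    rw [Nat.ceil_eq_iff (by simp), mem_Ioc, ← lt_sub_iff_add_lt', div_lt_iff₀ hn',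
      ← sub_le_iff_le_add', le_div_iff₀ hn']
    push_cast
    constructor <;> rintro ⟨h1, h2⟩ <;> constructor <;> linarith
  have h1 : 0 < ⌈(z + 1 / 2) * n⌉₊ := Nat.ceil_pos.2 hpos
  have h2 : ⌈(z + 1 / 2) * n⌉₊ ≤ n := Nat.ceil_le.2 hlt.le
  refine ⟨⌈(z + 1 / 2) * n⌉₊ - 1, Finset.mem_range.2 (by omega), fun i => ?_⟩
  rw [hiff]; omega

theorem volterraStep_ae (n : ℕ) (f : HL) : ∀ᵐ z ∂volume.restrict layer, volterraStep n f z =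
    ∑ i ∈ Finset.range n, (Ioc (-1 / 2 + i / n : ℝ) (-1 / 2 + (i + 1) / n)).indicator
      (fun _ => prim f (-1 / 2 + i / n)) z := by
  rw [volterraStep, sum_apply]
  have hi (i : ℕ) := indicatorConstLp_coeFn (p := 2)
    (hs := measurableSet_Ioc (a := (-1 / 2 + i / n : ℝ)) (b := -1 / 2 + (i + 1) / n))
    (hμs := measure_ne_top (volume.restrict layer) _) (c := (1 : ℂ))
  have hsm (i : ℕ) := Lp.coeFn_smul (prim f (-1 / 2 + i / n)) (indicatorConstLp 2
    (measurableSet_Ioc (a := (-1 / 2 + i / n : ℝ)) (b := -1 / 2 + (i + 1) / n))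
    (measure_ne_top (volume.restrict layer) _) (1 : ℂ))
  filter_upwards [coeFn_finsetSum (Finset.range n) _, ae_all_iff.2 hi, ae_all_iff.2 hsm]
    with z h1 h2 h3
  rw [h1]
  refine Finset.sum_congr rfl fun i hin => ?_
  have hmem : (-1 / 2 + i / n : ℝ) ∈ layer := by
    have hin' : (i : ℝ) < n := by exact_mod_cast Finset.mem_range.1 hin
    have h0 : (0 : ℝ) ≤ i / n := by positivity
    have h1 : (i : ℝ) / n ≤ 1 := div_le_one_of_le₀ hin'.le (by positivity)
    exact ⟨by linarith, by linarith⟩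
  rw [ContinuousLinearMap.smulRight_apply, innerSL_apply_apply,
    inner_indicator_Ioc f left_mem_layer hmem hmem.1, prim_left, sub_zero, h3, Pi.smul_apply, h2]
  by_cases hz : z ∈ Ioc (-1 / 2 + i / n : ℝ) (-1 / 2 + (i + 1) / n) <;> simp [hz]

/-- On each cell the step operator freezes the primitive at the left end, at distance at most 1/n.
The finite-rank step operators therefore converge in norm. -/
theorem norm_volterra_sub_le {n : ℕ} (hn : 0 < n) :
    ‖volterraStep n - volterra‖ ≤ Real.sqrt (1 / n) := by
  refine ContinuousLinearMap.opNorm_le_bound _ (Real.sqrt_nonneg _) fun f => ?_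
  refine norm_le_of_bound (by positivity) ?_
  have h2 := ae_layer_of_ae_Ioo (P := fun z => z ∈ Ioo (-1 / 2 : ℝ) (1 / 2))
    (ae_of_all _ fun z hz => hz)
  filter_upwards [Lp.coeFn_sub (volterraStep n f) (volterra f), volterraStep_ae n f,
    ae_layer_of_ae_Ioo (volterra_ae f), h2] with z h3 h4 h5 hz
  rw [sub_apply, h3, Pi.sub_apply, h4, h5]
  obtain ⟨j, hj, hji⟩ := exists_step hn hz
  have hjz := (hji j).2 rfl
  rw [Finset.sum_eq_single_of_mem j hj fun i _ hij => indicator_of_notMem (mt (hji i).1 hij) _,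
    indicator_of_mem hjz, norm_sub_rev]
  have hj0 : (0 : ℝ) ≤ j / n := by positivity
  refine (norm_prim_sub_le f ⟨by linarith, hjz.1.le.trans hz.2.le⟩ (Ioo_subset_Icc_self hz)
    hjz.1.le).trans ?_
  gcongr
  have : ((j : ℝ) + 1) / n = j / n + 1 / n := add_div _ _ _
  linarith [hjz.2]

theorem isCompactOperator_volterra : IsCompactOperator volterra := by
  refine isCompactOperator_of_tendsto (l := atTop) (F := volterraStep) ?_
    (Eventually.of_forall isCompactOperator_volterraStep)
  rw [tendsto_iff_norm_sub_tendsto_zero]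
  have h1 : Tendsto (fun n : ℕ => Real.sqrt (1 / n)) atTop (𝓝 0) := by
    have := (Real.continuous_sqrt.tendsto 0).comp tendsto_one_div_atTop_nhds_zero_nat
    rwa [Real.sqrt_zero] at this
  exact squeeze_zero' (Eventually.of_forall fun _ => norm_nonneg _)
    ((eventually_gt_atTop 0).mono fun n hn => norm_volterra_sub_le hn) h1

/-- By Lebesgue differentiation, f is almost everywhere the derivative of its primitive. -/
theorem ae_zero_of_prim_eq_zero {f : ℝ → ℂ} (hf : IL f) (h : ∀ z ∈ layer, prim f z = 0) :
    ∀ᵐ z, z ∈ Ioo (-1 / 2 : ℝ) (1 / 2) → f z = 0 := by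
  filter_upwards [hf.ae_hasDerivAt_integral] with z hz hm
  rw [uIcc_layer] at hz
  have h1 : HasDerivAt (prim f) (f z) z := hz (Ioo_subset_Icc_self hm) _ left_mem_layer
  have h2 : HasDerivAt (prim f) 0 z := by
    refine (hasDerivAt_const z 0).congr_of_eventuallyEq ?_
    filter_upwards [Icc_mem_nhds hm.1 hm.2] with x hx using h x hx
  exact h1.unique h2

/-! ### Multiplication operators and real test elements in L² -/

theorem memLp_top_of_continuousOn {m : ℝ → ℝ} (hm : ContinuousOn m layer) :
    MemLp (fun z => (m z : ℂ)) ⊤ (volume.restrict layer) := by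
  have hc : ContinuousOn (fun z => (m z : ℂ)) layer := by fun_prop
  obtain ⟨C, hC⟩ := isCompact_Icc.exists_bound_of_continuousOn hc
  exact MemLp.of_bound (hc.aestronglyMeasurable measurableSet_Icc) C
    ((ae_restrict_iff' measurableSet_Icc).2 (ae_of_all _ hC))

/-- Multiplication by a real continuous function. -/
noncomputable def mulOp (m : ℝ → ℝ) (hm : ContinuousOn m layer) : HL →L[ℂ] HL :=
  (ContinuousLinearMap.mul ℂ ℂ).holderL (volume.restrict layer) ⊤ 2 2
    (memLp_top_of_continuousOn hm).toLp

theorem mulOp_ae_layer {m : ℝ → ℝ} (hm : ContinuousOn m layer) (f : HL) :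
    ∀ᵐ z ∂volume.restrict layer, mulOp m hm f z = m z • f z := by
  filter_upwards [(ContinuousLinearMap.mul ℂ ℂ).coeFn_holder (r := 2)
    (memLp_top_of_continuousOn hm).toLp f,
    MemLp.coeFn_toLp (memLp_top_of_continuousOn hm)] with z h1 h2
  refine h1.trans ?_
  rw [h2, ContinuousLinearMap.mul_apply', Complex.real_smul]

theorem mulOp_ae {m : ℝ → ℝ} (hm : ContinuousOn m layer) (f : HL) :
    ∀ᵐ z, z ∈ Ioo (-1 / 2 : ℝ) (1 / 2) → mulOp m hm f z = m z • f z :=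
  ae_Ioo_of_ae_layer (mulOp_ae_layer hm f)

theorem inner_mulOp {m : ℝ → ℝ} (hm : ContinuousOn m layer) (f g : HL) :
    inner ℂ (mulOp m hm f) g = inner ℂ f (mulOp m hm g) := by
  rw [L2.inner_def, L2.inner_def]
  refine integral_congr_ae ?_
  filter_upwards [mulOp_ae_layer hm f, mulOp_ae_layer hm g] with z h1 h2
  rw [h1, h2, Complex.real_smul, Complex.real_smul, RCLike.inner_apply, RCLike.inner_apply, map_mul,
    Complex.conj_ofReal]
  ring

theorem le_re_inner_mulOp {m : ℝ → ℝ} (hm : ContinuousOn m layer) {a : ℝ}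
    (ha : ∀ z ∈ layer, a ≤ m z) (f : HL) : a * ‖f‖ ^ 2 ≤ (inner ℂ (mulOp m hm f) f).re := by
  have h0 : a * ‖f‖ ^ 2 = (inner ℂ ((a : ℂ) • f) f).re := by
    rw [inner_smul_left, Complex.conj_ofReal, Complex.re_ofReal_mul]
    exact congrArg _ (inner_self_eq_norm_sq (𝕜 := ℂ) f).symm
  rw [h0, ← sub_nonneg, ← Complex.sub_re, ← inner_sub_left, L2.inner_def]
  refine le_of_le_of_eq (integral_nonneg_of_ae ?_)
    (integral_re (L2.integrable_inner (𝕜 := ℂ) (mulOp m hm f - (a : ℂ) • f) f))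
  filter_upwards [Lp.coeFn_sub (mulOp m hm f) ((a : ℂ) • f), mulOp_ae_layer hm f,
    Lp.coeFn_smul (a : ℂ) f, ae_restrict_mem measurableSet_Icc] with z h1 h2 h3 hz
  have e : (mulOp m hm f - (a : ℂ) • f : HL) z = ((m z - a : ℝ) : ℂ) * f z := by
    rw [h1, Pi.sub_apply, h2, h3, Pi.smul_apply, Complex.real_smul, smul_eq_mul]; push_cast; ring
  have e2 : inner ℂ (((m z - a : ℝ) : ℂ) * f z) (f z) = (((m z - a) * ‖f z‖ ^ 2 : ℝ) : ℂ) := by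
    have := Complex.mul_conj' (f z)
    rw [RCLike.inner_apply, map_mul, Complex.conj_ofReal]
    push_cast
    linear_combination ((m z : ℂ) - a) * this
  rw [e, e2]
  exact mul_nonneg (sub_nonneg.2 (ha z hz)) (sq_nonneg _)

theorem inner_cl {h : ℝ → ℝ} (hh : ContinuousOn h layer) (f : HL) :
    inner ℂ (cl (fun z => (h z : ℂ)) (by fun_prop)) f = pair f h := by
  rw [L2.inner_def, pair, intervalIntegral.integral_of_le (by norm_num),
    ← integral_Icc_eq_integral_Ioc]
  refine integral_congr_ae ?_
  have hc : ContinuousOn (fun z => (h z : ℂ)) layer := by fun_prop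
  filter_upwards [MemLp.coeFn_toLp (InL2.of_continuousOn hc)] with z hz
  rw [show cl (fun z => (h z : ℂ)) hc z = h z from hz, RCLike.inner_apply, Complex.conj_ofReal,
    Complex.real_smul, mul_comm]

/-- Polynomials embed in L²: one vanishing almost everywhere on the layer has infinitely many roots.
-/
theorem not_finiteDimensional_HL : ¬FiniteDimensional ℂ HL := by
  intro hfin
  have hc (p : Polynomial ℂ) : ContinuousOn (fun z : ℝ => p.eval (z : ℂ)) layer :=
    (p.continuous.comp Complex.continuous_ofReal).continuousOn
  let L : Polynomial ℂ →ₗ[ℂ] HL :=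
    { toFun := fun p => cl (fun z : ℝ => p.eval (z : ℂ)) (hc p)
      map_add' := fun p q => by
        rw [← cl_add]
        exact cl_congr _ _ fun z _ => Polynomial.eval_add
      map_smul' := fun a p => by
        rw [RingHom.id_apply, ← cl_smul]
        exact cl_congr _ _ fun z _ => Polynomial.eval_smul a p z }
  refine Polynomial.not_finite (R := ℂ) (Module.Finite.of_injective L ?_)
  rw [← LinearMap.ker_eq_bot, LinearMap.ker_eq_bot']
  intro p hp
  have h1 : EqOn (fun z : ℝ => p.eval (z : ℂ)) 0 layer := by
    refine eqOn_layer_of_ae (hc p) continuousOn_const ?_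
    have h2 := ae_Ioo_of_ae_layer (Lp.coeFn_zero ℂ 2 (volume.restrict layer))
    have h3 : cl (fun z : ℝ => p.eval (z : ℂ)) (hc p) = 0 := hp
    filter_upwards [h2, cl_ae (hc p)] with z h4 h5 hz
    rw [← h5 hz, h3, h4 hz]
  refine Polynomial.eq_zero_of_infinite_isRoot p (Set.Infinite.mono ?_
    ((Icc_infinite (show (-1 / 2 : ℝ) < 1 / 2 by norm_num)).image
      Complex.ofReal_injective.injOn))
  rintro _ ⟨z, hz, rfl⟩
  exact h1 hz

theorem continuousOn_ofReal {h : ℝ → ℝ} (hh : ContinuousOn h layer) :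
    ContinuousOn (fun z => (h z : ℂ)) layer := by fun_prop

/-- The class of a real continuous function. -/
noncomputable def clr (h : ℝ → ℝ) (hh : ContinuousOn h layer) : HL :=
  cl (fun z => (h z : ℂ)) (continuousOn_ofReal hh)

theorem inner_clr {h : ℝ → ℝ} (hh : ContinuousOn h layer) (f : HL) :
    inner ℂ (clr h hh) f = pair f h := inner_cl hh f

theorem volterra_clr {h h' : ℝ → ℝ} (hc : ContinuousOn h layer) (hc' : ContinuousOn h' layer)
    (hd : ∀ z ∈ Ioo (-1 / 2 : ℝ) (1 / 2), HasDerivAt h (h' z) z) (h0 : h (-1 / 2) = 0) :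
    volterra (clr h' hc') = clr h hc :=
  volterra_cl _ _ (fun z hz => (hd z hz).ofReal_comp) (by simp [h0])

theorem pair_one (f : ℝ → ℂ) : pair f (fun _ => 1) = prim f (1 / 2) := by
  simp [pair, prim]

/-- The constant function `1`. -/
noncomputable def oneL : HL := clr (fun _ => 1) continuousOn_const

theorem inner_oneL (f : HL) : inner ℂ oneL f = prim f (1 / 2) := by
  rw [oneL, inner_clr, pair_one]

theorem inner_oneL_clr {h h' : ℝ → ℝ} (hc : ContinuousOn h layer) (hc' : ContinuousOn h' layer)
    (hd : ∀ z ∈ Ioo (-1 / 2 : ℝ) (1 / 2), HasDerivAt h (h' z) z) (hl : h (-1 / 2) = 0)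
    (hr : h (1 / 2) = 0) : inner ℂ oneL (clr h' hc') = 0 := by
  rw [inner_oneL, clr, prim_congr_ae (cl_ae (continuousOn_ofReal hc')) right_mem_layer,
    prim_eq_of_hasDerivAt (continuousOn_ofReal hc) (continuousOn_ofReal hc')
      (fun z hz => (hd z hz).ofReal_comp) right_mem_layer, hl, hr, sub_self]

theorem IsTest.continuousOn {φ : ℝ → ℝ} (hφ : IsTest φ) : ContinuousOn φ layer :=
  hφ.continuous.continuousOn

theorem IsTest.left {φ : ℝ → ℝ} (hφ : IsTest φ) : φ (-1 / 2) = 0 :=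
  hφ.eq_zero fun h => lt_irrefl _ h.1

theorem IsTest.right {φ : ℝ → ℝ} (hφ : IsTest φ) : φ (1 / 2) = 0 :=
  hφ.eq_zero fun h => lt_irrefl _ h.2

theorem IsTest.volterra_deriv {φ : ℝ → ℝ} (hφ : IsTest φ) :
    volterra (clr (deriv φ) hφ.deriv.continuousOn) = clr φ hφ.continuousOn :=
  volterra_clr _ _ (fun z _ => hφ.hasDerivAt z) hφ.left

theorem IsTest.inner_oneL_deriv {φ : ℝ → ℝ} (hφ : IsTest φ) :
    inner ℂ oneL (clr (deriv φ) hφ.deriv.continuousOn) = 0 :=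
  inner_oneL_clr hφ.continuousOn _ (fun z _ => hφ.hasDerivAt z) hφ.left hφ.right

theorem not_finiteDimensional_orthogonal (x : HL) : ¬FiniteDimensional ℂ ((ℂ ∙ x)ᗮ : Submodule ℂ HL) := by
  intro h
  have h1 : FiniteDimensional ℂ ((ℂ ∙ x) ⊔ (ℂ ∙ x)ᗮ : Submodule ℂ HL) := inferInstance
  rw [Submodule.sup_orthogonal_of_hasOrthogonalProjection] at h1
  exact not_finiteDimensional_HL (Module.finite_def.2 (Module.Finite.iff_fg.1 h1))

/-- `prim (prim u)` represents the square of the Volterra operator. -/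
theorem volterra_volterra_ae (u : HL) : ∀ᵐ z, z ∈ Ioo (-1 / 2 : ℝ) (1 / 2) →
    volterra (volterra u) z = prim (prim u) z := by
  filter_upwards [volterra_ae (volterra u)] with z hz hm
  rw [hz hm, prim_congr_ae (volterra_ae u) (Ioo_subset_Icc_self hm)]

theorem continuousOn_prim_coe (u : HL) : ContinuousOn (prim u) layer := continuousOn_prim (il_coe u)

theorem continuousOn_prim_prim (u : HL) : ContinuousOn (prim (prim u)) layer :=
  continuousOn_prim (IL.of_continuousOn (continuousOn_prim_coe u))

/-- The squared Volterra operator is injective even when tested only against test functions. This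
serves both for the injectivity of the coupling and for W ≠ 0. -/
theorem eq_zero_of_forall_test {u : HL}
    (h : ∀ φ (hφ : IsTest φ), inner ℂ (clr φ hφ.continuousOn) (volterra (volterra u)) = 0) :
    u = 0 := by
  have hW := continuousOn_prim_prim u
  have hW₁ := continuousOn_prim_coe u
  have h1 : EqOn (prim (prim u)) 0 layer := by
    refine eqOn_layer_of_ae hW continuousOn_const (ae_eq_zero_of_pair (.of_continuousOn hW) ?_)
    intro φ hφ
    rw [← pair_congr_ae (volterra_volterra_ae u), ← inner_clr hφ.continuousOn, h φ hφ]
  have h2 : EqOn (prim u) 0 layer := eqOn_layer_of_ae hW₁ continuousOn_const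
    (ae_zero_of_prim_eq_zero (.of_continuousOn hW₁) h1)
  rw [Lp.eq_zero_iff_ae_eq_zero]
  exact ae_layer_of_ae_Ioo (ae_zero_of_prim_eq_zero (il_coe u) h2)

/-! ### The variational eigenvalue problem and its regularity -/

/-- Variational form of the eigenvalue problem in the unknowns `u = D²W`, `v = DΘ`. -/
theorem exists_large_variational_eigenvalue {ν b c : ℝ → ℝ} {κ n₀ : ℝ} (hκ : 0 ≤ κ) (hn₀ : 0 < n₀)
    (hν : ContinuousOn ν layer) (hb : ContinuousOn b layer) (hc : ContinuousOn c layer)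
    (hν0 : ∀ z ∈ layer, n₀ ≤ ν z) (hb0 : ∀ z ∈ layer, 0 ≤ b z) (hc0 : ∀ z ∈ layer, 0 ≤ c z)
    (Λ : ℝ) :
    ∃ l : ℝ, Λ < l ∧ ∃ u v : HL, u ≠ 0 ∧ inner ℂ oneL (volterra u) = 0 ∧ inner ℂ oneL v = 0 ∧
      (∀ w, inner ℂ oneL w = 0 → inner ℂ w v + κ * inner ℂ (volterra w) (volterra v)
        = inner ℂ (volterra w) (volterra (volterra u))) ∧
      ∀ w, inner ℂ oneL (volterra w) = 0 →
        inner ℂ w (mulOp ν hν u) + inner ℂ (volterra w) (mulOp b hb (volterra u))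
          + inner ℂ (volterra (volterra w)) (mulOp c hc (volterra (volterra u)))
        = l * inner ℂ (volterra (volterra w)) (volterra v) := by
  obtain ⟨J, hJ⟩ : ∃ J, J = volterra := ⟨_, rfl⟩
  -- `V` encodes W(1/2) = 0 and `V₀` encodes Θ(1/2) = 0; the conditions at -1/2 are built into the
  -- primitives. No condition is put on W'' at 1/2.
  let V : Submodule ℂ HL := (ℂ ∙ (J.adjoint oneL))ᗮ
  let V₀ : Submodule ℂ HL := (ℂ ∙ oneL)ᗮ
  have hV (w : HL) : w ∈ V ↔ inner ℂ oneL (J w) = 0 := by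
    rw [Submodule.mem_orthogonal_singleton_iff_inner_right, ContinuousLinearMap.adjoint_inner_left]
  have hV₀ (w : HL) : w ∈ V₀ ↔ inner ℂ oneL w = 0 :=
    Submodule.mem_orthogonal_singleton_iff_inner_right
  -- B is the form of the W-operator and D that of -Θ'' + κΘ, while G pairs W with the test function
  -- for Θ; each is compressed to the constrained subspaces.
  let B : V →L[ℂ] V := V.subtypeL.adjoint ∘L (mulOp ν hν + J.adjoint ∘L mulOp b hb ∘L J
    + J.adjoint ∘L J.adjoint ∘L mulOp c hc ∘L J ∘L J) ∘L V.subtypeL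
  let D : V₀ →L[ℂ] V₀ := V₀.subtypeL.adjoint ∘L
    (ContinuousLinearMap.id ℂ HL + (κ : ℂ) • (J.adjoint ∘L J)) ∘L V₀.subtypeL
  let G : V →L[ℂ] V₀ := V₀.subtypeL.adjoint ∘L J.adjoint ∘L J ∘L J ∘L V.subtypeL
  have hB (x y : V) : inner ℂ (B x) y = inner ℂ (mulOp ν hν x) (y : HL)
      + inner ℂ (mulOp b hb (J x)) (J y) + inner ℂ (mulOp c hc (J (J x))) (J (J y)) := by
    simp only [B, ContinuousLinearMap.comp_apply, ContinuousLinearMap.adjoint_inner_left,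
      add_apply, inner_add_left, Submodule.subtypeL_apply]
  have hBr (x y : V) : inner ℂ y (B x) = inner ℂ (y : HL) (mulOp ν hν x)
      + inner ℂ (J y) (mulOp b hb (J x)) + inner ℂ (J (J y)) (mulOp c hc (J (J x))) := by
    simp only [B, ContinuousLinearMap.comp_apply, ContinuousLinearMap.adjoint_inner_right,
      add_apply, inner_add_right, Submodule.subtypeL_apply]
  have hD (x y : V₀) : inner ℂ (D x) y = inner ℂ (x : HL) (y : HL)
      + κ * inner ℂ (J x) (J y) := by
    simp only [D, ContinuousLinearMap.comp_apply, ContinuousLinearMap.adjoint_inner_left,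
      add_apply, smul_apply, inner_add_left, inner_smul_left,
      Submodule.subtypeL_apply, Complex.conj_ofReal, ContinuousLinearMap.id_apply]
  have hDr (x y : V₀) : inner ℂ y (D x) = inner ℂ (y : HL) (x : HL)
      + κ * inner ℂ (J y) (J x) := by
    simp only [D, ContinuousLinearMap.comp_apply, ContinuousLinearMap.adjoint_inner_right,
      add_apply, smul_apply, inner_add_right, inner_smul_right,
      Submodule.subtypeL_apply, ContinuousLinearMap.id_apply]
  have hG (x : V) (y : V₀) : inner ℂ (G x) y = inner ℂ (J (J x)) (J y) := by
    simp only [G, ContinuousLinearMap.comp_apply, ContinuousLinearMap.adjoint_inner_left,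
      Submodule.subtypeL_apply]
  have hGr (x : V) (y : V₀) : inner ℂ y (G x) = inner ℂ (J y) (J (J x)) := by
    simp only [G, ContinuousLinearMap.comp_apply, ContinuousLinearMap.adjoint_inner_right,
      Submodule.subtypeL_apply]
  have hBs : (B : V →ₗ[ℂ] V).IsSymmetric := fun x y => by
    rw [ContinuousLinearMap.coe_coe, hB, hBr, inner_mulOp, inner_mulOp, inner_mulOp]
  have hDs : (D : V₀ →ₗ[ℂ] V₀).IsSymmetric := fun x y => by
    rw [ContinuousLinearMap.coe_coe, hD, hDr]
  have hBc (x : V) : n₀ * ‖x‖ ^ 2 ≤ (inner ℂ (B x) x).re := by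
    rw [hB, Complex.add_re, Complex.add_re]
    have h1 := le_re_inner_mulOp hν hν0 x
    have h2 := le_re_inner_mulOp hb hb0 (J x)
    have h3 := le_re_inner_mulOp hc hc0 (J (J x))
    rw [zero_mul] at h2 h3
    rw [Submodule.coe_norm]
    linarith
  have hDc (x : V₀) : 1 * ‖x‖ ^ 2 ≤ (inner ℂ (D x) x).re := by
    rw [hD, Complex.add_re, Complex.re_ofReal_mul, one_mul, Submodule.coe_norm]
    have h1 := inner_self_eq_norm_sq (𝕜 := ℂ) (x : HL)
    have h2 : 0 ≤ (inner ℂ (J x) (J x)).re := inner_self_nonneg (𝕜 := ℂ)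
    have h3 := mul_nonneg hκ h2
    have h4 : (inner ℂ (x : HL) (x : HL)).re = ‖(x : HL)‖ ^ 2 := h1
    linarith
  have hGc : IsCompactOperator G := by
    have h1 : IsCompactOperator J := by rw [hJ]; exact isCompactOperator_volterra
    exact (h1.comp_clm V.subtypeL).clm_comp (V₀.subtypeL.adjoint ∘L J.adjoint ∘L J)
  have hGi (x : V) (hx : G x = 0) : x = 0 := by
    refine Subtype.ext (eq_zero_of_forall_test fun φ hφ => ?_)
    -- Testing against v = φ' recovers the pairing of W = J J x with φ.
    have h1 := hGr x ⟨clr (deriv φ) hφ.deriv.continuousOn, (hV₀ _).2 hφ.inner_oneL_deriv⟩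
    rw [hx, inner_zero_right, hJ, hφ.volterra_deriv] at h1
    exact h1.symm
  obtain ⟨l, hl, u, v, hu, hv, he⟩ := exists_large_coupled_eigenvalue hBs hn₀ hBc hDs one_pos hDc
    hGc hGi (not_finiteDimensional_orthogonal _) Λ
  subst hJ
  refine ⟨l, hl, u, v, fun h => hu (Subtype.ext h), (hV _).1 u.2, (hV₀ _).1 v.2,
    fun w hw => ?_, fun w hw => ?_⟩
  · rw [← hDr v ⟨w, (hV₀ w).2 hw⟩, hv, hGr]
  · rw [← hBr u ⟨w, (hV w).2 hw⟩, he, inner_smul_right, ContinuousLinearMap.adjoint_inner_right,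
      hG]

theorem prim_hasDerivAt_of_ae {f F : ℝ → ℂ} (hF : ContinuousOn F layer)
    (h : ∀ᵐ z, z ∈ Ioo (-1 / 2 : ℝ) (1 / 2) → f z = F z) :
    ∀ z ∈ Ioo (-1 / 2 : ℝ) (1 / 2), HasDerivAt (prim f) (F z) z := by
  intro z hz
  refine (hasDerivAt_prim hF hz).congr_of_eventuallyEq ?_
  filter_upwards [Icc_mem_nhds hz.1 hz.2] with x hx using prim_congr_ae h hx

theorem pair_coe_mulOp {m : ℝ → ℝ} (hm : ContinuousOn m layer) {f : HL} {F : ℝ → ℂ}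
    (h : ∀ᵐ z, z ∈ Ioo (-1 / 2 : ℝ) (1 / 2) → f z = F z) (φ : ℝ → ℝ) :
    pair (mulOp m hm f) φ = pair (fun z => m z • F z) φ := by
  refine pair_congr_ae ?_ φ
  filter_upwards [h, mulOp_ae hm f] with z h1 h2 hz
  rw [h2 hz, h1 hz]

/-- Testing with w = φ' for Θ and w = φ'' for W gives the equations in the sense of distributions.
One further admissible w, not compactly supported, yields the natural condition M(1/2) = 0. -/
theorem exists_large_classicalSol {ν b c : ℝ → ℝ} {κ : ℝ} (hκ : 0 ≤ κ)
    (hν : ContinuousOn ν layer) (hb : ContinuousOn b layer) (hc : ContinuousOn c layer)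
    (hpos : ∀ z ∈ layer, 0 < ν z) (hb0 : ∀ z ∈ layer, 0 ≤ b z) (hc0 : ∀ z ∈ layer, 0 ≤ c z)
    (Λ : ℝ) :
    ∃ l : ℝ, Λ < l ∧ ∃ W W₁ M N Θ T : ℝ → ℂ, ClassicalSol ν b c κ l W W₁ M N Θ T ∧
      ∃ z ∈ layer, W z ≠ 0 := by
  obtain ⟨n₀, hn₀, hν0⟩ := exists_pos_lower_bound hν hpos
  obtain ⟨l, hl, u, v, hu, hu1, hv1, hvw, huw⟩ :=
    exists_large_variational_eigenvalue hκ hn₀ hν hb hc hν0 hb0 hc0 Λ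
  have cW := continuousOn_prim_prim u
  have cW₁ := continuousOn_prim_coe u
  have cΘ := continuousOn_prim_coe v
  have hne : ∃ z ∈ layer, prim (prim u) z ≠ 0 := by
    by_contra! h
    refine hu (eq_zero_of_forall_test fun φ hφ => ?_)
    rw [inner_clr, pair_congr_ae (volterra_volterra_ae u),
      pair_congr_ae (g := 0) (ae_of_all _ fun z hz => h z (Ioo_subset_Icc_self hz))]
    simp [pair]
  have hinv : ContinuousOn (fun z => (ν z)⁻¹) layer := hν.inv₀ fun z hz => (hpos z hz).ne'
  obtain ⟨T, cT, dT, hvT⟩ := exists_continuous_rep (f := v)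
    (g := fun z => κ • prim v z - prim (prim u) z) (il_coe v) (by fun_prop) fun φ hφ => by
      have h1 := hvw _ hφ.inner_oneL_deriv
      rw [hφ.volterra_deriv, inner_clr, inner_clr, inner_clr, pair_congr_ae (volterra_ae v),
        pair_congr_ae (volterra_volterra_ae u)] at h1
      rw [pair_sub hφ (.of_continuousOn (by fun_prop)) (.of_continuousOn cW), pair_smul]
      linear_combination h1
  obtain ⟨M, N, cM, cN, dM, dN, huM⟩ := exists_ae_eq_of_pair_deriv_deriv
    (f := fun z => ν z • u z) (g := fun z => b z • prim u z)
    (h := fun z => l • prim v z - c z • prim (prim u) z) ((il_coe u).smul hν) (by fun_prop)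
    (by fun_prop) fun φ hφ => by
      have h1 := huw (clr (deriv (deriv φ)) hφ.deriv.deriv.continuousOn)
        (by rw [hφ.deriv.volterra_deriv]; exact hφ.inner_oneL_deriv)
      rw [hφ.deriv.volterra_deriv, hφ.volterra_deriv, inner_clr, inner_clr, inner_clr, inner_clr,
        pair_congr_ae (volterra_ae v), pair_congr_ae (mulOp_ae hν u),
        pair_coe_mulOp hb (volterra_ae u), pair_coe_mulOp hc (volterra_volterra_ae u)] at h1
      rw [pair_sub hφ (.of_continuousOn (by fun_prop)) (.of_continuousOn (by fun_prop)), pair_smul]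
      linear_combination h1
  have huM' : ∀ᵐ z, z ∈ Ioo (-1 / 2 : ℝ) (1 / 2) → u z = (ν z)⁻¹ • M z := by
    filter_upwards [huM] with z hz hm
    rw [← hz hm, inv_smul_smul₀ (hpos z (Ioo_subset_Icc_self hm)).ne']
  have rW : prim (prim u) (1 / 2) = 0 := by
    rw [← prim_congr_ae (volterra_ae u) right_mem_layer, ← inner_oneL, hu1]
  have rΘ : prim v (1 / 2) = 0 := by rw [← inner_oneL, hv1]
  have rM : M (1 / 2) = 0 := by
    -- This cubic meets the essential conditions h(±1/2) = h'(-1/2) = 0 and has h'(1/2) = 1, so the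
    -- only boundary term after integration by parts is M(1/2).
    let h : ℝ → ℝ := fun z => (z + 1 / 2) ^ 2 * (z - 1 / 2)
    let h₁ : ℝ → ℝ := fun z => (z + 1 / 2) * (3 * z - 1 / 2)
    let h₂ : ℝ → ℝ := fun z => 6 * z + 1
    have dh (z : ℝ) : HasDerivAt h (h₁ z) z := by
      refine ((((hasDerivAt_id z).add_const (1 / 2)).pow 2).mul
        ((hasDerivAt_id z).sub_const (1 / 2))).congr_deriv ?_
      simp [h₁]; ring
    have dh₁ (z : ℝ) : HasDerivAt h₁ (h₂ z) z := by
      refine (((hasDerivAt_id z).add_const (1 / 2)).mul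
        (((hasDerivAt_id z).const_mul 3).sub_const (1 / 2))).congr_deriv ?_
      simp [h₂]; ring
    have ch : ContinuousOn h layer := fun z _ => (dh z).continuousAt.continuousWithinAt
    have ch₁ : ContinuousOn h₁ layer := fun z _ => (dh₁ z).continuousAt.continuousWithinAt
    have ch₂ : ContinuousOn h₂ layer := by fun_prop
    have e1 := volterra_clr ch ch₁ (fun z _ => dh z) (by norm_num [h])
    have e2 := volterra_clr ch₁ ch₂ (fun z _ => dh₁ z) (by norm_num [h₁])
    have h1 := huw (clr h₂ ch₂) (by
      rw [e2]; exact inner_oneL_clr ch ch₁ (fun z _ => dh z) (by norm_num [h]) (by norm_num [h]))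
    rw [e2, e1, inner_clr, inner_clr, inner_clr, inner_clr,
      pair_congr_ae (volterra_ae v), pair_congr_ae (mulOp_ae hν u), pair_congr_ae huM,
      pair_coe_mulOp hb (volterra_ae u), pair_coe_mulOp hc (volterra_volterra_ae u)] at h1
    have hd : ∀ z ∈ Ioo (-1 / 2 : ℝ) (1 / 2), HasDerivAt (fun z => h₁ z • M z - h z • N z)
        (h₂ z • M z + h₁ z • (b z • prim u z) + h z • (c z • prim (prim u) z)
          - l • (h z • prim v z)) z := fun z hz => by
      refine (((dh₁ z).smul (dM z hz)).sub ((dh z).smul (dN z hz))).congr_deriv ?_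
      simp only [Complex.real_smul]; ring
    have i1 : IL fun z => h₂ z • M z := .of_continuousOn (by fun_prop)
    have i2 : IL fun z => h₁ z • (b z • prim u z) := .of_continuousOn (by fun_prop)
    have i3 : IL fun z => h z • (c z • prim (prim u) z) := .of_continuousOn (by fun_prop)
    have i4 : IL fun z => l • (h z • prim v z) := .of_continuousOn (by fun_prop)
    have h2 := intervalIntegral.integral_eq_sub_of_hasDerivAt_of_le
      (show (-1 / 2 : ℝ) ≤ 1 / 2 by norm_num)
      (show ContinuousOn (fun z => h₁ z • M z - h z • N z) layer by fun_prop) hd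
      (((i1.add i2).add i3).sub i4)
    rw [intervalIntegral.integral_sub ((i1.add i2).add i3) i4,
      intervalIntegral.integral_add (i1.add i2) i3, intervalIntegral.integral_add i1 i2,
      intervalIntegral.integral_smul, Complex.real_smul] at h2
    have h3 : (0 : ℂ) = M (1 / 2) := by
      refine ((sub_eq_zero.2 h1).symm.trans h2).trans ?_
      norm_num [h, h₁]
    exact h3.symm
  exact ⟨l, hl, prim (prim u), prim u, M, N, prim v, T,
    ⟨cW, cW₁, cM, cN, cΘ, cT, fun z hz => hasDerivAt_prim cW₁ hz,
      prim_hasDerivAt_of_ae (by fun_prop) huM', dM, dN, prim_hasDerivAt_of_ae cT hvT, dT,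
      prim_left _, prim_left _, prim_left _, rW, rM, rΘ⟩, hne⟩

/-! ### Existence of a large simple eigenvalue -/

theorem nuSecond_nonneg {ν : ℝ → ℝ} (hν : ContDiffOn ℝ 2 ν layer) (hconv : ConvexOn ℝ layer ν)
    (z : ℝ) : 0 ≤ nuSecond ν z := by
  rw [nuSecond, iteratedDerivWithin_succ, iteratedDerivWithin_one]
  exact (hconv.monotoneOn_derivWithin (hν.differentiableOn (by norm_num))).derivWithin_nonneg

theorem exists_eigenvalue {ν : ℝ → ℝ} {Pr : ℝ} (hν : ContDiffOn ℝ 2 ν layer)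
    (hpos : ∀ z ∈ layer, 0 < ν z) (hconv : ConvexOn ℝ layer ν) (hPr : 0 < Pr) {k σ : ℝ}
    (hk : k ≠ 0) (hσ : 0 ≤ σ) (r : ℝ) :
    ∃ R, r ≤ R ∧ HasUniqueNontrivialSolution ν Pr k σ R := by
  have hνc := hν.continuousOn
  have cb := continuousOn_coeffB hνc k (σ / Pr)
  have cc := continuousOn_coeffC hν k (σ / Pr)
  have hs : 0 ≤ σ / Pr := by positivity
  obtain ⟨Λ, hΛ⟩ := ClassicalSol.eq_zero (ν₁ := derivWithin ν layer) (k ^ 2 + σ) hνc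
    (hν.continuousOn_derivWithin (uniqueDiffOn_Icc (by norm_num)) (by norm_num))
    (fun z hz => hasDerivAt_of_contDiffOn hν hz) hpos cb cc
  -- Exceeding Λ gives simplicity; exceeding r k² gives R = l/k² ≥ r. Convexity of ν enters through
  -- c ≥ 0.
  obtain ⟨l, hl, W, W₁, M, N, Θ, T, h, z₀, hz₀, hW₀⟩ := exists_large_classicalSol
    (κ := k ^ 2 + σ) (by positivity) hνc cb cc hpos
    (fun z hz => by have := hpos z hz; unfold coeffB; positivity)
    (fun z hz => by
      have := hpos z hz
      have := nuSecond_nonneg hν hconv z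
      unfold coeffC; positivity) (max Λ (r * k ^ 2))
  have hk2 : 0 < k ^ 2 := by positivity
  have hR : l / k ^ 2 * k ^ 2 = l := div_mul_cancel₀ l hk2.ne'
  have hzero {W W₁ M N Θ T : ℝ → ℂ} (h : ClassicalSol ν (coeffB ν k (σ / Pr))
      (coeffC ν k (σ / Pr)) (k ^ 2 + σ) l W W₁ M N Θ T) (hT : T (-1 / 2) = 0) :
      ∀ z ∈ layer, W z = 0 ∧ Θ z = 0 := by
    have hle : Λ ≤ l := (le_max_left _ _).trans hl.le
    intro z hz
    have h1 := hΛ l hle _ _ _ _ _ _ (h.map Complex.reCLM) (by simp [hT]) z hz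
    have h2 := hΛ l hle _ _ _ _ _ _ (h.map Complex.imCLM) (by simp [hT]) z hz
    exact ⟨Complex.ext h1.1 h2.1, Complex.ext h1.2 h2.2⟩
  have hT0 : T (-1 / 2) ≠ 0 := fun hT => hW₀ (hzero h hT z₀ hz₀).1
  refine ⟨l / k ^ 2, ?_, 0, Θ, W, ?_, ⟨z₀, hz₀, Or.inr (Or.inr hW₀)⟩, fun Z' Θ' W' h' => ?_⟩
  · rw [le_div_iff₀ hk2]
    exact (le_max_right _ _).trans hl.le
  · refine ClassicalSol.isSolution (W₁ := W₁) (M := M) (N := N) (T := T) hν hpos ?_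
    rwa [hR]
  · obtain ⟨hZ', W₁', M', N', T', hc⟩ := h'.classical hν hpos hPr hk hσ
    rw [hR] at hc
    -- The only possible factor: it cancels Θ' at -1/2, so the difference of the solutions vanishes.
    refine ⟨T' (-1 / 2) / T (-1 / 2), fun z hz => ?_⟩
    have := hzero (hc.sub_smul h (T' (-1 / 2) / T (-1 / 2)))
      (by rw [div_mul_cancel₀ _ hT0, sub_self]) z hz
    exact ⟨by rw [hZ' z hz, Pi.zero_apply, mul_zero], sub_eq_zero.1 this.2, sub_eq_zero.1 this.1⟩

end Convection

theorem theorem6 (ν : ℝ → ℝ) (Pr : ℝ)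
    (hν_smooth : ContDiffOn ℝ 2 ν Convection.layer)
    (hν_pos : ∀ z ∈ Convection.layer, 0 < ν z)
    (hν_convex : ConvexOn ℝ Convection.layer ν)
    (hPr : 0 < Pr) :
    ∃ Rperp : ℝ → ℝ → ℝ, ∀ k σh : ℝ, k ≠ 0 → 0 ≤ σh →
      Convection.rStar ν k ≤ Rperp k σh ∧
      Convection.HasUniqueNontrivialSolution ν Pr k (σh * k ^ 2) (Rperp k σh) := by
  have key (k σh : ℝ) : ∃ R, k ≠ 0 → 0 ≤ σh → Convection.rStar ν k ≤ R ∧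
      Convection.HasUniqueNontrivialSolution ν Pr k (σh * k ^ 2) R := by
    by_cases h : k ≠ 0 ∧ 0 ≤ σh
    · obtain ⟨R, hR, hR'⟩ := Convection.exists_eigenvalue hν_smooth hν_pos hν_convex hPr h.1
        (mul_nonneg h.2 (sq_nonneg k)) (Convection.rStar ν k)
      exact ⟨R, fun _ _ => ⟨hR, hR'⟩⟩
    -- Default value outside the admissible parameters, so that `choose` yields a function defined
    -- everywhere.
    · exact ⟨0, fun h1 h2 => absurd ⟨h1, h2⟩ h⟩
  choose Rperp h using key
  exact ⟨Rperp, h⟩
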